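/- Let $\delta>-1$. For every $n\ge 1$ let $X_1,\dots,X_n$ be exponential random variables with rate $1+\delta$ and $Y_1,\dots,Y_n$ unit exponential random variables, all $2n$ of them independent, and let $X_{(1)}\le\dots\le X_{(n)}$ and $Y_{(1)}\le\dots\le Y_{(n)}$ be the order statistics of the two samples. Then, as $n\to\infty$: (i) (middle range) If $0<\alpha_n<\beta_n<1$ for all large $n$, if $\min\{\alpha_n,1-\beta_n\}\big/\sqrt{\log n/n}\to\infty$, and if the set $\Lambda_m=\{i\in\mathbb N:\alpha_n n<i<\beta_n n\}$ is non-empty for all large $n$, then $$\max_{i\in\Lambda_m}\frac{X_{(i)}}{Y_{(i)}}\ \xrightarrow{P}\ \frac1{1+\delta}.$$ (ii) (right end) For every integer $k\ge1$, $$\max_{n-k+1\le i\le n}\frac{X_{(i)}}{Y_{(i)}}\ \xrightarrow{P}\ \frac1{1+\delta}.$$ (iii) (left end) For every integer $k\ge1$, $\max_{1\le i\le k}X_{(i)}/Y_{(i)}$ converges in distribution to a non-degenerate probability law on $\mathbb R$, that is, one that is not a point mass. -/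

import Mathlib

open MeasureTheory ProbabilityTheory Filter Topology

/-- The order statistics of a finite sample `x`, in nondecreasing order. With zero-based indexing,
`orderStatistic x i` is the `(i + 1)`-th smallest entry of `x`, counted with multiplicity. -/
noncomputable def orderStatistic {n : ℕ} (x : Fin n → ℝ) (i : Fin n) : ℝ :=
  x (Tuple.sort x i)

/-- The maximum ranked quotient `max_{i ∈ Λ} x_(i) / y_(i)` of two samples of size `n`, where `Λ` is
a set of ranks and the ranks run from `1` to `n`. The supremum is over a finite index set, so it is
a maximum as soon as `Λ` contains a rank between `1` and `n`. -/
noncomputable def maxRankedQuotient {n : ℕ} (Λ : Set ℕ) (x y : Fin n → ℝ) : ℝ :=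
  ⨆ i : {i : Fin n // (i : ℕ) + 1 ∈ Λ}, orderStatistic x i / orderStatistic y i

/-- The middle ranks `{i : a n < i < b n}`. -/
def middleRanks (n : ℕ) (a b : ℝ) : Set ℕ :=
  {i | a * n < i ∧ (i : ℝ) < b * n}

/-- The top `k` ranks `{i : n - k + 1 ≤ i ≤ n}`. -/
def rightRanks (n k : ℕ) : Set ℕ :=
  {i | n + 1 ≤ i + k ∧ i ≤ n}

/-- The first `k` ranks `{i : 1 ≤ i ≤ k}`. -/
def leftRanks (k : ℕ) : Set ℕ :=
  {i | 1 ≤ i ∧ i ≤ k}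

/-- The growth condition on the truncation levels: `0 < α_n < β_n < 1` for all large `n`, and
`min {α_n, 1 - β_n} / √(log n / n) → ∞`. -/
structure TruncationCondition (α β : ℕ → ℝ) : Prop where
  eventually_mem : ∀ᶠ n in atTop, 0 < α n ∧ α n < β n ∧ β n < 1
  tendsto : Tendsto (fun n : ℕ => min (α n) (1 - β n) / √(Real.log n / n)) atTop atTop

open scoped ENNReal Nat

/-! Put `r = 1 + δ`. In the middle range and at the right end the order statistics concentrate: `r *
X_(i)` and `Y_(i)` both lie within a small relative error of one deterministic level, uniformly over
the ranks concerned, so every quotient is close to `1 / r` and so is their maximum. The level is the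
exponential quantile `-log (1 - i / n)` in the middle and `log n` for the top `k` ranks. An order
statistic is at most `t` exactly when enough sample points are, so the estimates concern sums of
independent indicators. In the middle, Hoeffding's inequality and a union bound over at most `n`
ranks suffice, and the `√(log n / n)` condition is what the union bound needs. At the right end a
union bound controls the maximum from above and Chebyshev's inequality gives the lower bound.

At the left end nothing concentrates. After multiplication by `n r` and `n`, both samples have rate
`1 / n`, and their smallest values behave like the first points of two independent unit Poisson
processes. The joint density of these values is explicit (`measurePreserving_leftOrderStatistics`),
converges pointwise, and is dominated by a product of exponentials (`scaledLeftDensity_le`).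
Dominated convergence identifies the limit of the maximum quotient. This limit is no point mass,
because the limiting density is positive on an open set where the quotient is continuous and not
constant. -/

/-! ### Order statistics, ranked quotients and scaling. -/

/-- Sorting does not change how many entries are at most `t`. This turns events about order
statistics into events about counts; the strict inequality reflects the zero-based index. -/
theorem orderStatistic_le_iff {n : ℕ} (x : Fin n → ℝ) (i : Fin n) (t : ℝ) :
    orderStatistic x i ≤ t ↔ (i : ℕ) < (Finset.univ.filter fun j => x j ≤ t).card := by
  have h := Tuple.lt_card_le_iff_apply_le_of_monotone (f := x ∘ Tuple.sort x) (a := t) (j := i)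
    (Tuple.monotone_sort x)
  have hc : (Finset.univ.filter fun j => x j ≤ t).card
      = (Finset.univ.filter fun j => (x ∘ Tuple.sort x) j ≤ t).card := by
    refine (Finset.card_equiv (Tuple.sort x) fun j => ?_).symm
    simp
  rw [hc, h]
  rfl

theorem measurable_orderStatistic {n : ℕ} (i : Fin n) :
    Measurable fun x : Fin n → ℝ => orderStatistic x i := by
  refine measurable_of_Iic fun t => ?_
  have hset : (fun x : Fin n → ℝ => orderStatistic x i) ⁻¹' Set.Iic t
      = {x | (i : ℕ) < ∑ j : Fin n, if x j ≤ t then 1 else 0} := by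
    ext x
    simp only [Set.mem_preimage, Set.mem_Iic, orderStatistic_le_iff, Set.mem_ofPred_eq,
      Finset.card_filter]
  rw [hset]
  refine measurableSet_lt measurable_const (Finset.measurable_sum _ fun j _ => ?_)
  exact Measurable.ite (measurableSet_le (measurable_pi_apply j) measurable_const)
    measurable_const measurable_const

theorem orderStatistic_const_mul {n : ℕ} {c : ℝ} (hc : 0 < c) (x : Fin n → ℝ) (i : Fin n) :
    orderStatistic (fun j => c * x j) i = c * orderStatistic x i := by
  refine eq_of_forall_ge_iff fun t => ?_
  rw [orderStatistic_le_iff, mul_comm c, ← le_div_iff₀ hc, orderStatistic_le_iff]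
  simp_rw [mul_comm c, ← le_div_iff₀ hc]

theorem orderStatistic_comp_perm {n : ℕ} (x : Fin n → ℝ) (e : Equiv.Perm (Fin n)) (i : Fin n) :
    orderStatistic (x ∘ e) i = orderStatistic x i :=
  congrFun (Tuple.comp_perm_comp_sort_eq_comp_sort (f := x) (σ := e)) i

theorem orderStatistic_of_monotone {n : ℕ} {x : Fin n → ℝ} (hx : Monotone x) (i : Fin n) :
    orderStatistic x i = x i := by
  rw [orderStatistic, Tuple.sort_eq_refl_iff_monotone.2 hx]
  rfl

theorem measurable_maxRankedQuotient {n : ℕ} (Λ : Set ℕ) :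
    Measurable fun p : (Fin n → ℝ) × (Fin n → ℝ) => maxRankedQuotient Λ p.1 p.2 := by
  unfold maxRankedQuotient
  exact Measurable.iSup fun i =>
    ((measurable_orderStatistic i.1).comp measurable_fst).div
      ((measurable_orderStatistic i.1).comp measurable_snd)

theorem abs_ciSup_sub_le {ι : Type*} [Finite ι] [Nonempty ι] {f : ι → ℝ} {c η : ℝ}
    (h : ∀ i, |f i - c| ≤ η) : |(⨆ i, f i) - c| ≤ η := by
  obtain ⟨i, hi⟩ := exists_eq_ciSup_of_finite (f := f)
  rw [← hi]
  exact h i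

theorem maxRankedQuotient_const_mul {n : ℕ} (Λ : Set ℕ) {c d : ℝ} (hc : 0 < c) (hd : 0 < d)
    (x y : Fin n → ℝ) :
    maxRankedQuotient Λ (fun j => c * x j) (fun j => d * y j)
      = c / d * maxRankedQuotient Λ x y := by
  unfold maxRankedQuotient
  rw [Real.mul_iSup_of_nonneg (by positivity)]
  simp_rw [orderStatistic_const_mul hc, orderStatistic_const_mul hd, mul_div_mul_comm]

theorem ProbabilityTheory.HasLaw.const_mul_expMeasure {Ω : Type*} [MeasurableSpace Ω] {P : Measure Ω} {Z : Ω → ℝ}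
    {r c : ℝ} (hr : 0 < r) (hc : 0 < c) (hZ : HasLaw Z (expMeasure r) P) :
    HasLaw (fun ω => c * Z ω) (expMeasure (r / c)) P := by
  have := isProbabilityMeasure_expMeasure hr
  have := isProbabilityMeasure_expMeasure (div_pos hr hc)
  have : IsProbabilityMeasure P := hZ.isProbabilityMeasure
  refine ⟨hZ.aemeasurable.const_mul c, ?_⟩
  have : IsProbabilityMeasure (P.map fun ω => c * Z ω) :=
    Measure.isProbabilityMeasure_map (hZ.aemeasurable.const_mul c)
  refine Measure.eq_of_cdf _ _ ?_
  ext x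
  rw [cdf_expMeasure_eq (div_pos hr hc), cdf_eq_real,
    map_measureReal_apply_of_aemeasurable (hZ.aemeasurable.const_mul c) measurableSet_Iic]
  have : (fun ω => c * Z ω) ⁻¹' Set.Iic x = Z ⁻¹' Set.Iic (x / c) := by
    ext ω
    simp [le_div_iff₀ hc, mul_comm]
  rw [this, ← map_measureReal_apply_of_aemeasurable hZ.aemeasurable measurableSet_Iic,
    hZ.map_eq, ← cdf_eq_real, cdf_expMeasure_eq hr]
  have h0 : 0 ≤ x / c ↔ 0 ≤ x := by rw [le_div_iff₀ hc, zero_mul]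
  simp only [h0]
  congr 3
  field_simp

theorem measureReal_Iic_expMeasure {r t : ℝ} (hr : 0 < r) (ht : 0 ≤ t) :
    (expMeasure r).real (Set.Iic t) = 1 - Real.exp (-(r * t)) := by
  have := isProbabilityMeasure_expMeasure hr
  rw [← cdf_eq_real, cdf_expMeasure_eq hr, if_pos ht]

/-! ### From uniform relative errors to convergence of the maximum quotient. -/

/-- The rescaled order statistics `r Z_(i)`, for ranks in `Λ n`, are uniformly within a relative
error that vanishes in probability of the levels `a n i`. -/
def UniformRelativeConvergence {Ω : Type*} [MeasurableSpace Ω] (P : Measure Ω) (r : ℝ)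
    (Λ : ℕ → Set ℕ) (a : (n : ℕ) → Fin n → ℝ) (Z : (n : ℕ) → Fin n → Ω → ℝ) : Prop :=
  ∀ ε : ℝ, 0 < ε → Tendsto (fun n => P {ω | ∃ i : Fin n, (i : ℕ) + 1 ∈ Λ n ∧
    ε * a n i < |r * orderStatistic (Z n · ω) i - a n i|}) atTop (𝓝 0)

/-- The difference is `(r x - y) / (r y)`. The bound `1 / 2` keeps `y ≥ a / 2`, and `η r / 8` makes
the numerator at most `η r a / 4`; the quotient of the two is `η / 2`. -/
theorem abs_div_sub_inv_lt {r η a x y : ℝ} (hr : 0 < r) (hη : 0 < η) (ha : 0 < a)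
    (hx : |r * x - a| ≤ min (1 / 2) (η * r / 8) * a)
    (hy : |1 * y - a| ≤ min (1 / 2) (η * r / 8) * a) : |x / y - 1 / r| ≤ η / 2 := by
  set ε := min (1 / 2) (η * r / 8)
  have h1 : ε ≤ 1 / 2 := min_le_left _ _
  have h2 : ε ≤ η * r / 8 := min_le_right _ _
  rw [one_mul] at hy
  have hy' : a / 2 ≤ y := by nlinarith [(abs_le.1 hy).1]
  have hy0 : 0 < y := by linarith
  have hxy : |r * x - y| ≤ 2 * ε * a := by
    have := abs_sub_le (r * x) a y
    rw [abs_sub_comm a y] at this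
    linarith
  have : x / y - 1 / r = (r * x - y) / (r * y) := by field_simp
  rw [this, abs_div, abs_of_pos (mul_pos hr hy0), div_le_iff₀ (mul_pos hr hy0)]
  have h3 : 2 * ε * a ≤ η * r / 4 * a := by nlinarith
  have h4 : η * r / 4 * a ≤ η / 2 * (r * y) := by
    have : 0 < η * r := mul_pos hη hr
    nlinarith
  linarith

theorem tendstoInMeasure_maxRankedQuotient {Ω : Type*} [MeasurableSpace Ω] {P : Measure Ω}
    {r : ℝ} (hr : 0 < r) {Λ : ℕ → Set ℕ} {a : (n : ℕ) → Fin n → ℝ}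
    {X Y : (n : ℕ) → Fin n → Ω → ℝ}
    (ha : ∀ᶠ n in atTop, ∀ i : Fin n, (i : ℕ) + 1 ∈ Λ n → 0 < a n i)
    (hΛ : ∀ᶠ n in atTop, ∃ i : Fin n, (i : ℕ) + 1 ∈ Λ n)
    (hX : UniformRelativeConvergence P r Λ a X) (hY : UniformRelativeConvergence P 1 Λ a Y) :
    TendstoInMeasure P (fun n ω => maxRankedQuotient (Λ n) (X n · ω) (Y n · ω))
      atTop (fun _ => 1 / r) := by
  rw [tendstoInMeasure_iff_dist]
  intro η hη
  have hε : 0 < min (1 / 2) (η * r / 8) := by positivity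
  have hsum := (hX _ hε).add (hY _ hε)
  rw [add_zero] at hsum
  refine tendsto_of_tendsto_of_tendsto_of_le_of_le' tendsto_const_nhds hsum
    (Eventually.of_forall fun _ => zero_le) ?_
  filter_upwards [ha, hΛ] with n han ⟨i₀, hi₀⟩
  refine (measure_mono ?_).trans (measure_union_le _ _)
  intro ω hω
  by_contra hcon
  rw [Set.mem_union, not_or] at hcon
  obtain ⟨h1, h2⟩ := hcon
  simp only [Set.mem_ofPred_eq, not_exists, not_and, not_lt] at h1 h2 hω
  -- Over an empty index type the real supremum takes the default value `0`, so a rank in `Λ n` is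
  -- essential.
  have : Nonempty {i : Fin n // (i : ℕ) + 1 ∈ Λ n} := ⟨⟨i₀, hi₀⟩⟩
  have hle : |maxRankedQuotient (Λ n) (X n · ω) (Y n · ω) - 1 / r| ≤ η / 2 :=
    abs_ciSup_sub_le fun i =>
      abs_div_sub_inv_lt hr hη (han i.1 i.2) (h1 i.1 i.2) (h2 i.1 i.2)
  rw [Real.dist_eq] at hω
  linarith

/-! ### Concentration of counts. -/

theorem sum_indicator_eq_card {Ω : Type*} {n : ℕ} {Z : Fin n → Ω → ℝ} (B : Set ℝ) [DecidablePred (· ∈ B)] (ω : Ω) :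
    ∑ j, (B.indicator 1 ∘ Z j : Ω → ℝ) ω
      = ((Finset.univ.filter fun j => Z j ω ∈ B).card : ℝ) := by
  rw [Finset.card_filter]
  push_cast
  exact Finset.sum_congr rfl fun j _ => by simp [Set.indicator_apply]

section Counts

variable {Ω : Type*} [MeasurableSpace Ω] {P : Measure Ω} {n : ℕ} {Z : Fin n → Ω → ℝ}
  {μ : Measure ℝ}

theorem integral_indicator_comp {W : Ω → ℝ} (hW : HasLaw W μ P) {B : Set ℝ}
    (hB : MeasurableSet B) : ∫ ω, (B.indicator 1 ∘ W : Ω → ℝ) ω ∂P = μ.real B := by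
  rw [hW.integral_comp ((measurable_one.indicator hB).aestronglyMeasurable),
    integral_indicator_one hB]

/-- Hoeffding's inequality: a centred indicator is sub-Gaussian with parameter `1 / 4`. The lower
tail below follows by passing to `Bᶜ`. -/
theorem measureReal_card_ge_le [IsProbabilityMeasure P] (hZ : ∀ j, HasLaw (Z j) μ P) (hind : iIndepFun Z P) {B : Set ℝ}
    [DecidablePred (· ∈ B)] (hB : MeasurableSet B) {s : ℝ} (hs : 0 ≤ s) :
    P.real {ω | n * (μ.real B + s) ≤ ((Finset.univ.filter fun j => Z j ω ∈ B).card : ℝ)}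
      ≤ Real.exp (-2 * n * s ^ 2) := by
  have hm : Measurable (B.indicator 1 : ℝ → ℝ) := measurable_one.indicator hB
  have hsub : ∀ j ∈ Finset.univ, HasSubgaussianMGF
      (fun ω => (B.indicator 1 ∘ Z j : Ω → ℝ) ω - μ.real B) ((‖(1 : ℝ) - 0‖₊ / 2) ^ 2) P := by
    intro j _
    rw [← integral_indicator_comp (hZ j) hB]
    refine hasSubgaussianMGF_of_mem_Icc (hm.comp_aemeasurable (hZ j).aemeasurable) ?_
    refine Eventually.of_forall fun ω => ?_
    by_cases h : Z j ω ∈ B <;> simp [h]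
  have hind' : iIndepFun (fun j ω => (B.indicator 1 ∘ Z j : Ω → ℝ) ω - μ.real B) P :=
    hind.comp (fun _ x => B.indicator 1 x - μ.real B) fun _ => hm.sub_const _
  have h := HasSubgaussianMGF.measure_sum_ge_le_of_iIndepFun hind' hsub
    (ε := n * s) (by positivity)
  refine (le_of_eq ?_).trans (h.trans (le_of_eq ?_))
  · congr 1
    ext ω
    simp only [Set.mem_ofPred_eq, Finset.sum_sub_distrib, sum_indicator_eq_card]
    simp only [Finset.sum_const, Finset.card_univ, Fintype.card_fin, nsmul_eq_mul]
    constructor <;> intro h <;> linarith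
  · congr 1
    rcases Nat.eq_zero_or_pos n with rfl | hn
    · simp
    · simp
      field_simp

theorem measureReal_card_le_le [IsProbabilityMeasure P] (hZ : ∀ j, HasLaw (Z j) μ P) (hind : iIndepFun Z P) {B : Set ℝ}
    [DecidablePred (· ∈ B)] (hB : MeasurableSet B) {s : ℝ} (hs : 0 ≤ s) :
    P.real {ω | ((Finset.univ.filter fun j => Z j ω ∈ B).card : ℝ) ≤ n * (μ.real B - s)}
      ≤ Real.exp (-2 * n * s ^ 2) := by
  rcases Nat.eq_zero_or_pos n with rfl | hn
  · simp
  have : IsProbabilityMeasure μ := (hZ ⟨0, hn⟩).isProbabilityMeasure_iff.1 inferInstance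
  refine le_trans (le_of_eq ?_) (measureReal_card_ge_le hZ hind hB.compl hs)
  congr 1
  ext ω
  have hc := Finset.card_filter_add_card_filter_not (s := (Finset.univ : Finset (Fin n)))
    (fun j => Z j ω ∈ B)
  have hc' : ((Finset.univ.filter fun j => Z j ω ∈ B).card : ℝ)
      + ((Finset.univ.filter fun j => Z j ω ∈ Bᶜ).card : ℝ) = n := by
    simp only [Set.mem_compl_iff]
    exact_mod_cast hc.trans (by simp)
  simp only [Set.mem_ofPred_eq]
  rw [probReal_compl_eq_one_sub hB]
  constructor <;> intro h <;> linarith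

/-- Chebyshev's inequality, with the variance of the count bounded by its mean because an indicator
equals its square. At the right end the mean is only `n ^ ε` with `ε ≤ 1 / 2`, too small for
Hoeffding's inequality to help. -/
theorem measure_card_le_le_div [IsProbabilityMeasure P] (hZ : ∀ j, HasLaw (Z j) μ P) (hind : iIndepFun Z P) {B : Set ℝ}
    [DecidablePred (· ∈ B)] (hB : MeasurableSet B) {k : ℝ} (hk : k < n * μ.real B) :
    P {ω | ((Finset.univ.filter fun j => Z j ω ∈ B).card : ℝ) ≤ k}
      ≤ ENNReal.ofReal (n * μ.real B / (n * μ.real B - k) ^ 2) := by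
  have hm : Measurable (B.indicator 1 : ℝ → ℝ) := measurable_one.indicator hB
  set I : Fin n → Ω → ℝ := fun j => B.indicator 1 ∘ Z j with hI
  have hIm : ∀ j, AEMeasurable (I j) P := fun j => hm.comp_aemeasurable (hZ j).aemeasurable
  have hmem : ∀ j, MemLp (I j) 2 P := by
    intro j
    refine MemLp.of_bound (hIm j).aestronglyMeasurable 1 (Eventually.of_forall fun ω => ?_)
    by_cases h : Z j ω ∈ B <;> simp [hI, h]
  have hmemS : MemLp (∑ j, I j) 2 P := memLp_finsetSum' _ fun j _ => hmem j
  have hint : ∫ ω, (∑ j, I j) ω ∂P = n * μ.real B := by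
    simp only [Finset.sum_apply]
    rw [integral_finsetSum _ fun j _ => (hmem j).integrable (by norm_num)]
    simp only [hI, integral_indicator_comp (hZ _) hB]
    simp
  have hvar : variance (∑ j, I j) P ≤ n * μ.real B := by
    rw [IndepFun.variance_sum (fun j _ => hmem j)
      fun i _ j _ hij => (hind.comp (fun _ => B.indicator 1) fun _ => hm).indepFun hij]
    calc ∑ j, variance (I j) P ≤ ∑ j : Fin n, μ.real B := by
          refine Finset.sum_le_sum fun j _ => ?_
          refine (variance_le_expectation_sq (hIm j).aestronglyMeasurable).trans (le_of_eq ?_)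
          rw [← integral_indicator_comp (hZ j) hB]
          congr 1
          ext ω
          by_cases h : Z j ω ∈ B <;> simp [hI, h]
      _ = n * μ.real B := by simp
  have hpos : 0 < n * μ.real B - k := by linarith
  refine le_trans (measure_mono ?_) ((meas_ge_le_variance_div_sq hmemS hpos).trans
    (ENNReal.ofReal_le_ofReal (by gcongr)))
  intro ω hω
  simp only [Set.mem_ofPred_eq] at hω ⊢
  rw [hint, Finset.sum_apply]
  simp only [hI, sum_indicator_eq_card]
  rw [abs_sub_comm]
  exact le_trans (by linarith) (le_abs_self _)

end Counts

/-! ### Middle ranks. -/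

/-- Bernoulli's inequality gives `1 - q ^ ε ≥ ε (1 - q)`, and `q (1 - q) ≥ m / 2` since one factor
is at least `1 / 2`. This and its companion bound the change of the exponential distribution
function when its quantile at `1 - q` is multiplied by `1 + ε` or `1 - ε`. -/
theorem half_mul_le_sub_rpow {q ε m : ℝ} (hq : 0 < q) (hq1 : q < 1) (hε : 0 < ε) (hε1 : ε ≤ 1)
    (hmq : m ≤ q) (hmp : m ≤ 1 - q) :
    ε / 2 * m ≤ q - q ^ (1 + ε) := by
  have hb : q ^ ε ≤ 1 - ε * (1 - q) := by
    have := rpow_one_add_le_one_add_mul_self (s := q - 1) (by linarith) hε.le hε1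
    rw [add_sub_cancel] at this
    linarith
  rw [Real.rpow_add hq, Real.rpow_one]
  have h1 : q * (ε * (1 - q)) ≤ q - q * q ^ ε := by nlinarith
  have h2 : m / 2 ≤ q * (1 - q) := by
    rcases le_total q (1 / 2) with h | h <;> nlinarith
  nlinarith

theorem half_mul_le_rpow_sub {q ε m : ℝ} (hq : 0 < q) (hq1 : q < 1) (hε : 0 < ε) (hε1 : ε ≤ 1)
    (hmq : m ≤ q) (hmp : m ≤ 1 - q) :
    ε / 2 * m ≤ q ^ (1 - ε) - q := by
  have hb : q ^ ε ≤ 1 - ε * (1 - q) := by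
    have := rpow_one_add_le_one_add_mul_self (s := q - 1) (by linarith) hε.le hε1
    rw [add_sub_cancel] at this
    linarith
  have hmul : q ^ (1 - ε) * q ^ ε = q := by
    rw [← Real.rpow_add hq, sub_add_cancel, Real.rpow_one]
  have hge : q ≤ q ^ (1 - ε) := by
    have := Real.rpow_le_rpow_of_exponent_ge hq hq1.le (show 1 - ε ≤ 1 by linarith)
    rwa [Real.rpow_one] at this
  have h2 : m / 2 ≤ q * (1 - q) := by
    rcases le_total q (1 / 2) with h | h <;> nlinarith
  have h3 : q ^ (1 - ε) * (ε * (1 - q)) ≤ q ^ (1 - ε) - q := by nlinarith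
  have h4 : q * (ε * (1 - q)) ≤ q ^ (1 - ε) * (ε * (1 - q)) :=
    mul_le_mul_of_nonneg_right hge (by nlinarith)
  nlinarith

section Middle

variable {Ω : Type*} [MeasurableSpace Ω] {P : Measure Ω} [IsProbabilityMeasure P] {n : ℕ} {r : ℝ}
  {Z : Fin n → Ω → ℝ}

/-- If the order statistic is too large, at most `i` points lie below `1 + ε` times the quantile,
although at least `i + 1 + n ε m / 2` are expected there; the other tail is symmetric. Hoeffding's
inequality applies with deviation `ε m / 2`. -/
theorem measureReal_relative_deviation_le (hr : 0 < r)
    (hZ : ∀ j, HasLaw (Z j) (expMeasure r) P) (hind : iIndepFun Z P) {ε m : ℝ} (hε : 0 < ε)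
    (hε1 : ε ≤ 1) (hm : 0 ≤ m) (i : Fin n) (hi : m ≤ ((i : ℕ) + 1 : ℝ) / n)
    (hi' : m ≤ 1 - ((i : ℕ) + 1 : ℝ) / n) (hi1 : ((i : ℕ) + 1 : ℝ) / n < 1) :
    P.real {ω | ε * -Real.log (1 - ((i : ℕ) + 1 : ℝ) / n)
        < |r * orderStatistic (Z · ω) i - -Real.log (1 - ((i : ℕ) + 1 : ℝ) / n)|}
      ≤ 2 * Real.exp (-2 * n * (ε / 2 * m) ^ 2) := by
  classical
  have hn : (0 : ℝ) < n := by exact_mod_cast i.pos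
  set q := 1 - ((i : ℕ) + 1 : ℝ) / n with hqdef
  have hp0 : 0 < ((i : ℕ) + 1 : ℝ) / n := by positivity
  have hq : 0 < q := by linarith
  have hq1 : q < 1 := by linarith
  have hiq : ((i : ℕ) + 1 : ℝ) = n * (1 - q) := by rw [hqdef]; field_simp; ring
  have hlog : 0 < -Real.log q := neg_pos.2 (Real.log_neg hq hq1)
  have hexp : ∀ x : ℝ, 0 ≤ x → (expMeasure r).real (Set.Iic (x * -Real.log q / r))
      = 1 - q ^ x := by
    intro x hx
    rw [measureReal_Iic_expMeasure hr (by positivity), Real.rpow_def_of_pos hq]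
    congr 2
    field_simp
  have hs : 0 ≤ ε / 2 * m := by positivity
  have hup := measureReal_card_le_le hZ hind
    (measurableSet_Iic (a := (1 + ε) * -Real.log q / r)) hs
  have hlo := measureReal_card_ge_le hZ hind
    (measurableSet_Iic (a := (1 - ε) * -Real.log q / r)) hs
  rw [hexp _ (by linarith)] at hup hlo
  have hb1 := half_mul_le_sub_rpow (m := m) hq hq1 hε hε1 hi' (by linarith)
  have hb2 := half_mul_le_rpow_sub (m := m) hq hq1 hε hε1 hi' (by linarith)
  refine le_trans (measureReal_mono ?_) ((measureReal_union_le _ _).trans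
    ((add_le_add hup hlo).trans_eq (two_mul _).symm))
  intro ω hω
  simp only [Set.mem_ofPred_eq] at hω
  rcases lt_abs.1 hω with h | h
  · left
    simp only [Set.mem_ofPred_eq, Set.mem_Iic]
    have h1 : ¬ orderStatistic (Z · ω) i ≤ (1 + ε) * -Real.log q / r := by
      rw [le_div_iff₀ hr, not_le]
      linarith
    rw [orderStatistic_le_iff, not_lt] at h1
    have h2 : ((Finset.univ.filter fun j => Z j ω ≤ (1 + ε) * -Real.log q / r).card : ℝ) ≤ i := by
      exact_mod_cast h1
    have h3 : n * (1 - q) ≤ n * (1 - q ^ (1 + ε) - ε / 2 * m) :=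
      mul_le_mul_of_nonneg_left (by linarith) hn.le
    linarith
  · right
    simp only [Set.mem_ofPred_eq, Set.mem_Iic]
    have h1 : orderStatistic (Z · ω) i ≤ (1 - ε) * -Real.log q / r := by
      rw [le_div_iff₀ hr]
      linarith
    rw [orderStatistic_le_iff] at h1
    have h2 : (i : ℝ) + 1
        ≤ ((Finset.univ.filter fun j => Z j ω ≤ (1 - ε) * -Real.log q / r).card : ℝ) := by
      exact_mod_cast h1
    have h3 : n * (1 - q ^ (1 - ε) + ε / 2 * m) ≤ n * (1 - q) :=
      mul_le_mul_of_nonneg_left (by linarith) hn.le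
    linarith

end Middle

theorem TruncationCondition.eventually_log_le {α β : ℕ → ℝ} (h : TruncationCondition α β) {c : ℝ}
    (hc : 0 < c) : ∀ᶠ n : ℕ in atTop,
      c * Real.log n ≤ n * min (α n) (1 - β n) ^ 2 := by
  filter_upwards [h.tendsto.eventually_ge_atTop (√c), eventually_gt_atTop 1] with n hn hn1
  have hn0 : (0 : ℝ) < n := by positivity
  have hlog : 0 < Real.log n := Real.log_pos (by exact_mod_cast hn1)
  have hs : 0 < √(Real.log n / n) := Real.sqrt_pos.2 (by positivity)
  rw [le_div_iff₀ hs] at hn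
  have h2 : (√c * √(Real.log n / n)) ^ 2 ≤ min (α n) (1 - β n) ^ 2 :=
    pow_le_pow_left₀ (by positivity) hn 2
  rw [mul_pow, Real.sq_sqrt hc.le, Real.sq_sqrt (by positivity)] at h2
  calc c * Real.log n = n * (c * (Real.log n / n)) := by field_simp
    _ ≤ _ := by gcongr

theorem uniformRelativeConvergence_middleRanks {Ω : Type*} [MeasurableSpace Ω] {P : Measure Ω}
    [IsProbabilityMeasure P] {r : ℝ} (hr : 0 < r) {Z : (n : ℕ) → Fin n → Ω → ℝ}
    (hZ : ∀ n j, HasLaw (Z n j) (expMeasure r) P) (hind : ∀ n, iIndepFun (Z n) P)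
    {α β : ℕ → ℝ} (h : TruncationCondition α β) :
    UniformRelativeConvergence P r (fun n => middleRanks n (α n) (β n))
      (fun n i => -Real.log (1 - ((i : ℕ) + 1 : ℝ) / n)) Z := by
  intro ε₀ hε₀
  -- Bernoulli's inequality requires an exponent at most `1`.
  set ε := min ε₀ 1 with hεdef
  have hε : 0 < ε := by positivity
  have hε1 : ε ≤ 1 := min_le_right _ _
  have hlim : Tendsto (fun n : ℕ => ENNReal.ofReal (2 / (n : ℝ))) atTop (𝓝 0) := by
    rw [← ENNReal.ofReal_zero]
    exact ENNReal.tendsto_ofReal (tendsto_const_div_atTop_nhds_zero_nat 2)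
  refine tendsto_of_tendsto_of_tendsto_of_le_of_le' tendsto_const_nhds hlim
    (Eventually.of_forall fun _ => zero_le) ?_
  -- The constant `4 / ε ^ 2` makes the Hoeffding exponent at least `2 log n`: each rank fails with
  -- probability at most `2 / n ^ 2`, and all of them together with at most `2 / n`.
  filter_upwards [h.eventually_mem, h.eventually_log_le (c := 4 / ε ^ 2) (by positivity),
    eventually_gt_atTop 1] with n ⟨hα, hαβ, hβ⟩ hlog hn1
  have hn0 : (0 : ℝ) < n := by positivity
  set m := min (α n) (1 - β n) with hmdef
  have hm : 0 < m := lt_min hα (by linarith)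
  have hexp : Real.exp (-2 * n * (ε / 2 * m) ^ 2) ≤ ((n : ℝ) ^ 2)⁻¹ := by
    rw [← Real.exp_log (show (0 : ℝ) < n ^ 2 by positivity), ← Real.exp_neg]
    refine Real.exp_le_exp.2 ?_
    rw [Real.log_pow]
    have : 4 / ε ^ 2 * Real.log n * (ε ^ 2 / 2) ≤ n * m ^ 2 * (ε ^ 2 / 2) := by gcongr
    have h2 : 4 / ε ^ 2 * Real.log n * (ε ^ 2 / 2) = 2 * Real.log n := by field_simp; ring
    push_cast
    nlinarith
  set A : Fin n → Set Ω := fun i => {ω | (i : ℕ) + 1 ∈ middleRanks n (α n) (β n) ∧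
    ε₀ * -Real.log (1 - ((i : ℕ) + 1 : ℝ) / n)
        < |r * orderStatistic (Z n · ω) i - -Real.log (1 - ((i : ℕ) + 1 : ℝ) / n)|} with hA
  have hAle : ∀ i, P (A i) ≤ ENNReal.ofReal (2 * ((n : ℝ) ^ 2)⁻¹) := by
    intro i
    by_cases hi : (i : ℕ) + 1 ∈ middleRanks n (α n) (β n)
    · obtain ⟨hi1, hi2⟩ := hi
      push_cast at hi1 hi2
      rw [← lt_div_iff₀ hn0] at hi1
      rw [← div_lt_iff₀ hn0] at hi2
      have hlt : ((i : ℕ) + 1 : ℝ) / n < 1 := hi2.trans hβ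
      have hpos : 0 < -Real.log (1 - ((i : ℕ) + 1 : ℝ) / n) :=
        neg_pos.2 (Real.log_neg (by linarith) (by linarith [hα.trans hi1]))
      have hdev := measureReal_relative_deviation_le hr (hZ n) (hind n) hε hε1 hm.le i
        ((min_le_left _ _).trans hi1.le) ((min_le_right _ _).trans (by linarith)) hlt
      rw [← ofReal_measureReal]
      refine ENNReal.ofReal_le_ofReal ((measureReal_mono ?_).trans (hdev.trans (by gcongr)))
      intro ω hω
      refine lt_of_le_of_lt ?_ hω.2
      gcongr
      exact min_le_left _ _
    · have : A i = ∅ := by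
        ext ω
        simp [hA, hi]
      simp [this]
  calc P _ ≤ P (⋃ i, A i) := measure_mono fun ω hω => by
        obtain ⟨i, hi⟩ := hω
        exact Set.mem_iUnion.2 ⟨i, hi⟩
    _ ≤ ∑ i, P (A i) := measure_iUnion_fintype_le _ _
    _ ≤ ∑ _i : Fin n, ENNReal.ofReal (2 * ((n : ℝ) ^ 2)⁻¹) := Finset.sum_le_sum fun i _ => hAle i
    _ = ENNReal.ofReal (2 / n) := by
      rw [Finset.sum_const, Finset.card_univ, Fintype.card_fin, ← ENNReal.ofReal_nsmul,
        nsmul_eq_mul]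
      congr 1
      field_simp

/-! ### Right end. -/

/-- Some point exceeds `(1 + ε) log n / r` with probability at most `n * n ^ (-(1 + ε)) = n ^ (-ε)`.
If a top-`k` order statistic is below `(1 - ε) log n / r`, at most `k` points exceed that level,
although `n ^ ε` are expected to. -/
theorem uniformRelativeConvergence_rightRanks {Ω : Type*} [MeasurableSpace Ω] {P : Measure Ω}
    [IsProbabilityMeasure P] {r : ℝ} (hr : 0 < r) {Z : (n : ℕ) → Fin n → Ω → ℝ}
    (hZ : ∀ n j, HasLaw (Z n j) (expMeasure r) P) (hind : ∀ n, iIndepFun (Z n) P) (k : ℕ) :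
    UniformRelativeConvergence P r (fun n => rightRanks n k) (fun n _ => Real.log n) Z := by
  classical
  intro ε₀ hε₀
  set ε := min ε₀ (1 / 2) with hεdef
  have hε : 0 < ε := by positivity
  have hε1 : ε ≤ 1 / 2 := min_le_right _ _
  have hpr := isProbabilityMeasure_expMeasure hr
  have htend : Tendsto (fun n : ℕ => (n : ℝ) ^ ε) atTop atTop :=
    (tendsto_rpow_atTop hε).comp tendsto_natCast_atTop_atTop
  have hlim1 : Tendsto (fun n : ℕ => ENNReal.ofReal ((n : ℝ) ^ ε)⁻¹) atTop (𝓝 0) := by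
    rw [← ENNReal.ofReal_zero]
    exact ENNReal.tendsto_ofReal htend.inv_tendsto_atTop
  have hlim2 : Tendsto (fun n : ℕ => ENNReal.ofReal (4 * ((n : ℝ) ^ ε)⁻¹)) atTop (𝓝 0) := by
    rw [← ENNReal.ofReal_zero]
    have := htend.inv_tendsto_atTop.const_mul (4 : ℝ)
    rw [mul_zero] at this
    exact ENNReal.tendsto_ofReal this
  have hlim := hlim1.add hlim2
  rw [add_zero] at hlim
  refine tendsto_of_tendsto_of_tendsto_of_le_of_le' tendsto_const_nhds hlim
    (Eventually.of_forall fun _ => zero_le) ?_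
  -- Then `n ^ ε - k ≥ n ^ ε / 2`, which yields the factor `4` in the Chebyshev bound.
  filter_upwards [eventually_gt_atTop 1, htend.eventually_ge_atTop (2 * (k : ℝ) + 1)]
    with n hn1 hnk
  have hn0 : (0 : ℝ) < n := by positivity
  have hlog : 0 < Real.log n := Real.log_pos (by exact_mod_cast hn1)
  have htail : ∀ x : ℝ, 0 ≤ x → (expMeasure r).real (Set.Ioi (x * Real.log n / r))
      = (n : ℝ) ^ (-x) := by
    intro x hx
    rw [← Set.compl_Iic, probReal_compl_eq_one_sub measurableSet_Iic,
      measureReal_Iic_expMeasure hr (by positivity), Real.rpow_def_of_pos hn0]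
    rw [sub_sub_cancel]
    congr 1
    field_simp
  set U : Fin n → Set Ω := fun j => {ω | (1 + ε) * Real.log n / r < Z n j ω} with hU
  set L : Set Ω := {ω | ((Finset.univ.filter fun j => Z n j ω
    ∈ Set.Ioi ((1 - ε) * Real.log n / r)).card : ℝ) ≤ k} with hL
  have hUle : P (⋃ j, U j) ≤ ENNReal.ofReal ((n : ℝ) ^ ε)⁻¹ := by
    calc P (⋃ j, U j) ≤ ∑ j, P (U j) := measure_iUnion_fintype_le _ _
      _ = ∑ _j : Fin n, ENNReal.ofReal ((n : ℝ) ^ (-(1 + ε))) := by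
        refine Finset.sum_congr rfl fun j _ => ?_
        rw [← htail _ (by linarith), ofReal_measureReal]
        exact (hZ n j).measure_eq (p := fun x => (1 + ε) * Real.log n / r < x) measurableSet_Ioi
      _ = ENNReal.ofReal ((n : ℝ) ^ ε)⁻¹ := by
        rw [Finset.sum_const, Finset.card_univ, Fintype.card_fin, ← ENNReal.ofReal_nsmul,
          nsmul_eq_mul, neg_add, Real.rpow_add hn0, Real.rpow_neg_one, Real.rpow_neg hn0.le]
        congr 1
        field_simp
  have hLle : P L ≤ ENNReal.ofReal (4 * ((n : ℝ) ^ ε)⁻¹) := by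
    have hmean : n * (expMeasure r).real (Set.Ioi ((1 - ε) * Real.log n / r)) = (n : ℝ) ^ ε := by
      rw [htail _ (by linarith), neg_sub, Real.rpow_sub hn0, Real.rpow_one]
      field_simp
    have h := measure_card_le_le_div (hZ n) (hind n)
      (measurableSet_Ioi (a := (1 - ε) * Real.log n / r)) (k := k) (by rw [hmean]; linarith)
    rw [hmean] at h
    refine h.trans (ENNReal.ofReal_le_ofReal ?_)
    have hk0 : (0 : ℝ) ≤ k := k.cast_nonneg
    have hM : (0 : ℝ) < (n : ℝ) ^ ε := by positivity
    rw [div_le_iff₀ (by nlinarith), mul_assoc, ← div_eq_inv_mul, ← mul_div_assoc,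
      le_div_iff₀ hM]
    nlinarith
  refine le_trans (measure_mono ?_) ((measure_union_le (⋃ j, U j) L).trans (add_le_add hUle hLle))
  rintro ω ⟨i, hi, hω⟩
  have hω' : ε * Real.log n < |r * orderStatistic (Z n · ω) i - Real.log n| :=
    lt_of_le_of_lt (by gcongr; exact min_le_left _ _) hω
  rcases lt_abs.1 hω' with h | h
  · left
    refine Set.mem_iUnion.2 ⟨Tuple.sort (Z n · ω) i, ?_⟩
    change _ < orderStatistic (Z n · ω) i
    rw [div_lt_iff₀ hr]
    linarith
  · right
    have h1 : orderStatistic (Z n · ω) i ≤ (1 - ε) * Real.log n / r := by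
      rw [le_div_iff₀ hr]
      linarith
    rw [orderStatistic_le_iff] at h1
    have hc := Finset.card_filter_add_card_filter_not (s := (Finset.univ : Finset (Fin n)))
      (fun j => Z n j ω ≤ (1 - ε) * Real.log n / r)
    simp only [not_le, Finset.card_univ, Fintype.card_fin] at hc
    have hi1 : n + 1 ≤ (i : ℕ) + 1 + k := hi.1
    simp only [hL, Set.mem_ofPred_eq, Set.mem_Ioi]
    exact_mod_cast (by omega)

/-! ### Joint law of the smallest order statistics of an atomless law. -/

theorem isOpen_strictMono (n : ℕ) : IsOpen {x : Fin n → ℝ | StrictMono x} := by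
  have : {x : Fin n → ℝ | StrictMono x} = ⋂ i, ⋂ j, ⋂ (_ : i < j), {x | x i < x j} := by
    ext x
    simp [StrictMono]
  rw [this]
  exact isOpen_iInter_of_finite fun i => isOpen_iInter_of_finite fun j =>
    isOpen_iInter_of_finite fun _ => isOpen_lt (continuous_apply i) (continuous_apply j)

theorem ae_pi_injective (μ : Measure ℝ) [IsProbabilityMeasure μ] [NullSingletonClass μ] (n : ℕ) :
    ∀ᵐ x ∂Measure.pi (fun _ : Fin n => μ), Function.Injective x := by
  have hne : ∀ i j : Fin n, i ≠ j → ∀ᵐ x ∂Measure.pi (fun _ : Fin n => μ), x i ≠ x j := by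
    intro i j hij
    have hind : IndepFun (fun x : Fin n → ℝ => x i) (fun x => x j)
        (Measure.pi fun _ : Fin n => μ) :=
      (iIndepFun_pi (μ := fun _ : Fin n => μ) (X := fun _ => id)
        fun _ => aemeasurable_id).indepFun hij
    have hmap := hind.map_prod_eq_prod_map_map (measurable_pi_apply i).aemeasurable
      (measurable_pi_apply j).aemeasurable
    rw [(measurePreserving_eval (fun _ : Fin n => μ) i).map_eq,
      (measurePreserving_eval (fun _ : Fin n => μ) j).map_eq] at hmap
    have hD : MeasurableSet {p : ℝ × ℝ | p.1 = p.2} :=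
      measurableSet_eq_fun measurable_fst measurable_snd
    have hnull : (μ.prod μ) {p : ℝ × ℝ | p.1 = p.2} = 0 := by
      rw [Measure.measure_prod_null hD]
      refine Eventually.of_forall fun x => ?_
      have : Prod.mk x ⁻¹' {p : ℝ × ℝ | p.1 = p.2} = {x} := by
        ext y
        simp [eq_comm]
      change μ (Prod.mk x ⁻¹' {p : ℝ × ℝ | p.1 = p.2}) = 0
      rw [this]
      exact measure_singleton x
    rw [← hmap, Measure.map_apply (by fun_prop) hD] at hnull
    rw [ae_iff]
    simpa using hnull
  have hall : ∀ᵐ x ∂Measure.pi (fun _ : Fin n => μ), ∀ i j : Fin n, i ≠ j → x i ≠ x j := by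
    rw [ae_all_iff]
    intro i
    rw [ae_all_iff]
    intro j
    by_cases hij : i = j
    · simp [hij]
    · filter_upwards [hne i j hij] with x hx _ using hx
  filter_upwards [hall] with x hx i j hxij
  by_contra h
  exact hx i j h hxij

theorem measurePreserving_comp_perm (μ : Measure ℝ) [SigmaFinite μ] {n : ℕ}
    (e : Equiv.Perm (Fin n)) :
    MeasurePreserving (fun x : Fin n → ℝ => x ∘ e) (Measure.pi fun _ => μ)
      (Measure.pi fun _ => μ) := by
  have hm : Measurable fun x : Fin n → ℝ => x ∘ e :=
    measurable_pi_iff.2 fun i => measurable_pi_apply _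
  refine ⟨hm, (Measure.pi_eq fun s hs => ?_).symm⟩
  rw [Measure.map_apply hm (MeasurableSet.univ_pi hs)]
  have : (fun x : Fin n → ℝ => x ∘ e) ⁻¹' Set.univ.pi s = Set.univ.pi fun i => s (e.symm i) := by
    ext x
    simp only [Set.mem_preimage, Set.mem_univ_pi, Function.comp_apply]
    exact ⟨fun h i => by simpa using h (e.symm i), fun h i => by simpa using h (e i)⟩
  rw [this, Measure.pi_pi]
  exact Equiv.prod_comp e.symm fun i => μ (s i)

/-- Ties have probability zero, so almost surely exactly one permutation sorts the sample. The `n !`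
chambers contribute equally, since both `G` and the product measure are permutation invariant. -/
theorem lintegral_pi_eq_factorial_mul (μ : Measure ℝ) [IsProbabilityMeasure μ]
    [NullSingletonClass μ] {n : ℕ} {G : (Fin n → ℝ) → ℝ≥0∞} (hG : Measurable G)
    (hsymm : ∀ x (e : Equiv.Perm (Fin n)), G (x ∘ e) = G x) :
    ∫⁻ x, G x ∂Measure.pi (fun _ => μ)
      = n ! * ∫⁻ x in {x | StrictMono x}, G x ∂Measure.pi (fun _ => μ) := by
  classical
  set S : Set (Fin n → ℝ) := {x | StrictMono x} with hS
  have hSm : MeasurableSet S := (isOpen_strictMono n).measurableSet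
  have hsum : ∀ᵐ x ∂Measure.pi (fun _ : Fin n => μ),
      G x = ∑ e : Equiv.Perm (Fin n), S.indicator G (x ∘ e) := by
    filter_upwards [ae_pi_injective μ n] with x hx
    rw [Finset.sum_eq_single (Tuple.sort x)]
    · have : x ∘ Tuple.sort x ∈ S :=
        (Tuple.monotone_sort x).strictMono_of_injective (hx.comp (Tuple.sort x).injective)
      rw [Set.indicator_of_mem this, hsymm]
    · intro e _ he
      refine Set.indicator_of_notMem (fun hmem => he ?_) _
      have hmono : Monotone (x ∘ e) := StrictMono.monotone hmem
      have := Tuple.comp_sort_eq_comp_iff_monotone.2 hmono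
      ext i
      exact congrArg _ (hx (congrFun this i))
    · simp
  rw [lintegral_congr_ae hsum, lintegral_finsetSum']
  · have : ∀ e : Equiv.Perm (Fin n),
        ∫⁻ x, S.indicator G (x ∘ e) ∂Measure.pi (fun _ => μ)
          = ∫⁻ x in S, G x ∂Measure.pi (fun _ => μ) := by
      intro e
      rw [(measurePreserving_comp_perm μ e).lintegral_comp (hG.indicator hSm),
        lintegral_indicator hSm]
    simp [this, Fintype.card_perm]
  · exact fun e _ => ((hG.indicator hSm).comp
      (measurePreserving_comp_perm μ e).measurable).aemeasurable

theorem measurable_append (k m : ℕ) :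
    Measurable fun p : (Fin k → ℝ) × (Fin m → ℝ) => Fin.append p.1 p.2 := by
  refine measurable_pi_iff.2 fun i => ?_
  refine Fin.addCases (fun i => ?_) (fun i => ?_) i
  · simp only [Fin.append_left]
    fun_prop
  · simp only [Fin.append_right]
    fun_prop

theorem measurePreserving_append (μ : Measure ℝ) [SigmaFinite μ] (k m : ℕ) :
    MeasurePreserving (fun p : (Fin k → ℝ) × (Fin m → ℝ) => Fin.append p.1 p.2)
      ((Measure.pi fun _ => μ).prod (Measure.pi fun _ => μ)) (Measure.pi fun _ => μ) := by
  refine ⟨measurable_append k m, (Measure.pi_eq fun s hs => ?_).symm⟩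
  rw [Measure.map_apply (measurable_append k m) (MeasurableSet.univ_pi hs)]
  have : (fun p : (Fin k → ℝ) × (Fin m → ℝ) => Fin.append p.1 p.2) ⁻¹' Set.univ.pi s
      = (Set.univ.pi fun i => s (Fin.castAdd m i)) ×ˢ (Set.univ.pi fun i => s (Fin.natAdd k i)) := by
    ext p
    simp only [Set.mem_preimage, Set.mem_univ_pi, Set.mem_prod]
    constructor
    · exact fun h => ⟨fun i => by simpa using h (Fin.castAdd m i),
        fun i => by simpa using h (Fin.natAdd k i)⟩
    · rintro ⟨h1, h2⟩ i
      refine Fin.addCases (fun i => ?_) (fun i => ?_) i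
      · simpa using h1 i
      · simpa using h2 i
  rw [this, Measure.prod_prod, Measure.pi_pi, Measure.pi_pi, Fin.prod_univ_add]

theorem strictMono_append_iff {k m : ℕ} (u : Fin k → ℝ) (v : Fin m → ℝ) :
    StrictMono (Fin.append u v) ↔ StrictMono u ∧ StrictMono v ∧ ∀ j i, u i < v j := by
  constructor
  · intro h
    refine ⟨fun i j hij => ?_, fun i j hij => ?_, fun j i => ?_⟩
    · simpa using h (show Fin.castAdd m i < Fin.castAdd m j from hij)
    · simpa using h (show Fin.natAdd k i < Fin.natAdd k j by simpa using hij)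
    · simpa using h (show Fin.castAdd m i < Fin.natAdd k j from
        Fin.lt_def.2 (by simp; omega))
  · rintro ⟨hu, hv, huv⟩ i j
    refine Fin.addCases (fun i => ?_) (fun i => ?_) i <;>
      refine Fin.addCases (fun j => ?_) (fun j => ?_) j <;> intro hij
    · simpa using hu (show i < j from hij)
    · simpa using huv j i
    · have := Fin.lt_def.1 hij
      simp at this
      omega
    · simpa using hv (show i < j by simpa using hij)

/-- On the sorted chamber, split a vector into its first `k` entries `u` and the other `m`, which
are sorted and lie above `u`. Dropping the order of the latter costs `m !` and leaves a product
event. Keeping the factorials as factors avoids division in `ℝ≥0∞`. -/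
theorem factorial_mul_lintegral_orderStatistic (μ : Measure ℝ) [IsProbabilityMeasure μ]
    [NullSingletonClass μ] (k m : ℕ) {F : (Fin k → ℝ) → ℝ≥0∞} (hF : Measurable F) :
    m ! * ∫⁻ x, F (fun i => orderStatistic x (Fin.castAdd m i)) ∂Measure.pi (fun _ => μ)
      = (k + m)! * ∫⁻ u in {u | StrictMono u}, F u * μ {y | ∀ i, u i < y} ^ m
          ∂Measure.pi (fun _ => μ) := by
  have hmeas : Measurable fun x : Fin (k + m) → ℝ =>
      F (fun i => orderStatistic x (Fin.castAdd m i)) :=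
    hF.comp (measurable_pi_iff.2 fun i => measurable_orderStatistic _)
  have hSk := (isOpen_strictMono k).measurableSet
  have hSm := (isOpen_strictMono m).measurableSet
  have hSkm := (isOpen_strictMono (k + m)).measurableSet
  rw [lintegral_pi_eq_factorial_mul μ hmeas fun x e => by simp only [orderStatistic_comp_perm]]
  rw [mul_left_comm]
  congr 1
  have h1 : ∫⁻ x in {x | StrictMono x}, F (fun i => orderStatistic x (Fin.castAdd m i))
        ∂Measure.pi (fun _ : Fin (k + m) => μ)
      = ∫⁻ x in {x | StrictMono x}, F (fun i => x (Fin.castAdd m i))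
        ∂Measure.pi (fun _ : Fin (k + m) => μ) := by
    refine setLIntegral_congr_fun hSkm fun x hx => ?_
    simp only [orderStatistic_of_monotone (StrictMono.monotone hx)]
  have hF' : Measurable fun x : Fin (k + m) → ℝ => F (fun i => x (Fin.castAdd m i)) :=
    hF.comp (measurable_pi_iff.2 fun i => measurable_pi_apply _)
  have hA : ∀ u : Fin k → ℝ, MeasurableSet {y : ℝ | ∀ i, u i < y} := fun u => by
    have : {y : ℝ | ∀ i, u i < y} = ⋂ i, Set.Ioi (u i) := by
      ext y
      simp
    rw [this]
    exact MeasurableSet.iInter fun i => measurableSet_Ioi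
  rw [h1, ← lintegral_indicator hSkm,
    ← (measurePreserving_append μ k m).lintegral_comp (hF'.indicator hSkm),
    lintegral_prod (fun p : (Fin k → ℝ) × (Fin m → ℝ) =>
      Set.indicator {x : Fin (k + m) → ℝ | StrictMono x}
        (fun x => F fun i => x (Fin.castAdd m i)) (Fin.append p.1 p.2))
      ((hF'.indicator hSkm).comp (measurable_append k m)).aemeasurable,
    ← lintegral_const_mul' _ _ (by simp), ← lintegral_indicator hSk]
  congr 1
  ext u
  by_cases hu : StrictMono u
  · rw [Set.indicator_of_mem (show u ∈ {u : Fin k → ℝ | StrictMono u} from hu)]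
    set V : Set (Fin m → ℝ) := Set.univ.pi fun _ => {y : ℝ | ∀ i, u i < y} with hV
    have hVm : MeasurableSet V := MeasurableSet.univ_pi fun _ => hA u
    have hsplit : ∀ v : Fin m → ℝ, Set.indicator {x : Fin (k + m) → ℝ | StrictMono x}
        (fun x => F (fun i => x (Fin.castAdd m i))) (Fin.append u v)
        = F u * Set.indicator {v : Fin m → ℝ | StrictMono v} (V.indicator 1) v := by
      intro v
      have hiff := strictMono_append_iff u v
      by_cases hv : StrictMono v ∧ v ∈ V
      · rw [Set.indicator_of_mem (show v ∈ {v : Fin m → ℝ | StrictMono v} from hv.1),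
          Set.indicator_of_mem hv.2, Set.indicator_of_mem
            (show Fin.append u v ∈ {x : Fin (k + m) → ℝ | StrictMono x} from
              hiff.2 ⟨hu, hv.1, fun j => hv.2 j (Set.mem_univ j)⟩)]
        simp
      · rw [Set.indicator_of_notMem (s := {x : Fin (k + m) → ℝ | StrictMono x}) fun h =>
          hv ⟨(hiff.1 h).2.1, fun j _ => (hiff.1 h).2.2 j⟩]
        by_cases hv1 : StrictMono v
        · rw [Set.indicator_of_mem (show v ∈ {v : Fin m → ℝ | StrictMono v} from hv1),
            Set.indicator_of_notMem fun h => hv ⟨hv1, h⟩, mul_zero]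
        · rw [Set.indicator_of_notMem (s := {v : Fin m → ℝ | StrictMono v}) hv1, mul_zero]
    simp_rw [hsplit]
    -- Symmetrization is used backwards here: `m !` times the integral over sorted tails is the full
    -- measure of the box `V`.
    rw [lintegral_const_mul _ ((measurable_one.indicator hVm).indicator hSm),
      lintegral_indicator hSm, mul_left_comm,
      ← lintegral_pi_eq_factorial_mul μ (measurable_one.indicator hVm), lintegral_indicator_one hVm,
      hV, Measure.pi_pi]
    · simp
    · intro x e
      have : x ∘ e ∈ V ↔ x ∈ V := by
        simp only [hV, Set.mem_univ_pi, Function.comp_apply]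
        exact ⟨fun h i => by simpa using h (e.symm i), fun h i => h (e i)⟩
      by_cases hx : x ∈ V
      · rw [Set.indicator_of_mem hx, Set.indicator_of_mem (this.2 hx)]
        rfl
      · rw [Set.indicator_of_notMem hx, Set.indicator_of_notMem (mt this.1 hx)]
  · rw [Set.indicator_of_notMem (s := {u : Fin k → ℝ | StrictMono u}) hu]
    have : ∀ v : Fin m → ℝ, Set.indicator {x : Fin (k + m) → ℝ | StrictMono x}
        (fun x => F (fun i => x (Fin.castAdd m i))) (Fin.append u v) = 0 := fun v =>
      Set.indicator_of_notMem (s := {x : Fin (k + m) → ℝ | StrictMono x})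
        (fun h => hu ((strictMono_append_iff u v).1 h).1) _
    simp [this]

theorem lintegral_fin_prod_eq_prod {n : ℕ} {μ : Fin n → Measure ℝ} [∀ i, SigmaFinite (μ i)]
    {f : ℝ → ℝ≥0∞} (hf : Measurable f) :
    ∫⁻ x, ∏ i, f (x i) ∂Measure.pi μ = ∏ i, ∫⁻ y, f y ∂μ i := by
  induction n with
  | zero => simp
  | succ n ih =>
    rw [← ((measurePreserving_piFinSuccAbove μ 0).symm).lintegral_comp_emb
      (MeasurableEquiv.measurableEmbedding _)]
    simp_rw [MeasurableEquiv.piFinSuccAbove_symm_apply, Fin.insertNthEquiv,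
      Fin.prod_univ_succ, Equiv.coe_fn_mk, Fin.insertNth_zero, Fin.zero_succAbove,
      Fin.cons_succ, Fin.cons_zero, cast_eq]
    rw [lintegral_prod_mul (μ := μ 0) (ν := Measure.pi fun j => μ j.succ) (f := f)
      (g := fun x : Fin n → ℝ => ∏ i, f (x i)) hf.aemeasurable
      (Finset.measurable_prod _ fun i _ => hf.comp (measurable_pi_apply i)).aemeasurable, ih]

theorem pi_withDensity {n : ℕ} {ν : Measure ℝ} [SigmaFinite ν] {f : ℝ → ℝ≥0∞}
    (hf : Measurable f) [SigmaFinite (ν.withDensity f)] :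
    Measure.pi (fun _ : Fin n => ν.withDensity f)
      = (Measure.pi fun _ : Fin n => ν).withDensity fun x => ∏ i, f (x i) := by
  refine Measure.pi_eq fun s hs => ?_
  rw [withDensity_apply _ (MeasurableSet.univ_pi hs), Measure.restrict_pi_pi,
    lintegral_fin_prod_eq_prod hf]
  exact Finset.prod_congr rfl fun i _ => (withDensity_apply _ (hs i)).symm

/-! ### Left end: the scaled density and its limit. -/

instance nullSingletonClass_expMeasure (r : ℝ) : NullSingletonClass (expMeasure r) := by
  unfold expMeasure gammaMeasure
  infer_instance

theorem expMeasure_Ioi {r : ℝ} (hr : 0 < r) (t : ℝ) :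
    expMeasure r (Set.Ioi t) = ENNReal.ofReal (Real.exp (-(r * max t 0))) := by
  have := isProbabilityMeasure_expMeasure hr
  rw [← ofReal_measureReal, ← Set.compl_Iic, probReal_compl_eq_one_sub measurableSet_Iic,
    ← cdf_eq_real, cdf_expMeasure_eq hr]
  congr 1
  split_ifs with h
  · rw [max_eq_left h, sub_sub_cancel]
  · rw [max_eq_right (not_le.1 h).le]
    simp

/-- The increasing sequences of `k + 1` nonnegative numbers. -/
def leftCone (k : ℕ) : Set (Fin (k + 1) → ℝ) :=
  {u | (∀ i, 0 ≤ u i) ∧ StrictMono u}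

/-- The joint density of the `k + 1` smallest values of a sample of `n` exponential variables of
rate `1 / n`. -/
noncomputable def scaledLeftDensity (k n : ℕ) : (Fin (k + 1) → ℝ) → ℝ :=
  (leftCone k).indicator fun u => n.descFactorial (k + 1) / (n : ℝ) ^ (k + 1) *
    Real.exp (-((∑ i, u i) / n + (n - (k + 1)) * u (Fin.last k) / n))

/-- The joint density of the first `k + 1` points of a unit Poisson process on the half-line. -/
noncomputable def limitLeftDensity (k : ℕ) : (Fin (k + 1) → ℝ) → ℝ :=
  (leftCone k).indicator fun u => Real.exp (-u (Fin.last k))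

theorem measurableSet_leftCone (k : ℕ) : MeasurableSet (leftCone k) := by
  have : leftCone k = (⋂ i, {u : Fin (k + 1) → ℝ | 0 ≤ u i}) ∩ {u | StrictMono u} := by
    ext u
    simp [leftCone]
  rw [this]
  exact (MeasurableSet.iInter fun i => measurableSet_le measurable_const
    (measurable_pi_apply i)).inter (isOpen_strictMono _).measurableSet

theorem measurable_scaledLeftDensity (k n : ℕ) : Measurable (scaledLeftDensity k n) :=
  Measurable.indicator (by fun_prop) (measurableSet_leftCone k)

theorem measurable_limitLeftDensity (k : ℕ) : Measurable (limitLeftDensity k) :=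
  Measurable.indicator (by fun_prop) (measurableSet_leftCone k)

theorem scaledLeftDensity_nonneg (k n : ℕ) (u : Fin (k + 1) → ℝ) : 0 ≤ scaledLeftDensity k n u :=
  Set.indicator_nonneg (fun _ _ => by positivity) u

theorem limitLeftDensity_nonneg (k : ℕ) (u : Fin (k + 1) → ℝ) : 0 ≤ limitLeftDensity k u :=
  Set.indicator_nonneg (fun _ _ => by positivity) u

theorem factorial_mul_prod_exponentialPDF (k m : ℕ) {u : Fin (k + 1) → ℝ} (hu : u ∈ leftCone k) :
    ((k + 1 + m)! : ℝ≥0∞) * ((∏ i, exponentialPDF (1 / ((k + 1 + m : ℕ) : ℝ)) (u i)) *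
        ENNReal.ofReal (Real.exp (-(1 / ((k + 1 + m : ℕ) : ℝ) * max (u (Fin.last k)) 0))) ^ m)
      = m ! * ENNReal.ofReal (scaledLeftDensity k (k + 1 + m) u) := by
  have hN : (0 : ℝ) < ((k + 1 + m : ℕ) : ℝ) := by positivity
  have hprod : ∏ i, exponentialPDF (1 / ((k + 1 + m : ℕ) : ℝ)) (u i) = ENNReal.ofReal
      (∏ i, (1 / ((k + 1 + m : ℕ) : ℝ) * Real.exp (-(1 / ((k + 1 + m : ℕ) : ℝ) * u i)))) := by
    rw [ENNReal.ofReal_prod_of_nonneg fun i _ => by positivity]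
    exact Finset.prod_congr rfl fun i _ => exponentialPDF_of_nonneg (hu.1 i)
  have hfac : ((k + 1 + m)! : ℝ) = m ! * ((k + 1 + m).descFactorial (k + 1) : ℕ) := by
    have := Nat.factorial_mul_descFactorial (show k + 1 ≤ k + 1 + m by omega)
    rw [Nat.add_sub_cancel_left] at this
    exact_mod_cast this.symm
  rw [hprod, max_eq_left (hu.1 _), ← ENNReal.ofReal_pow (by positivity),
    ← ENNReal.ofReal_mul (Finset.prod_nonneg fun i _ => by positivity),
    ← ENNReal.ofReal_natCast, ← ENNReal.ofReal_natCast (m !),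
    ← ENNReal.ofReal_mul (by positivity), ← ENNReal.ofReal_mul (by positivity)]
  congr 1
  rw [scaledLeftDensity, Set.indicator_of_mem hu, hfac, Finset.prod_mul_distrib, Finset.prod_const,
    Finset.card_univ, Fintype.card_fin, ← Real.exp_sum, ← Real.exp_nat_mul]
  have hexp : Real.exp (∑ i, -(1 / ((k + 1 + m : ℕ) : ℝ) * u i))
      * Real.exp (m * -(1 / ((k + 1 + m : ℕ) : ℝ) * u (Fin.last k)))
      = Real.exp (-((∑ i, u i) / ((k + 1 + m : ℕ) : ℝ)
        + (((k + 1 + m : ℕ) : ℝ) - (k + 1)) * u (Fin.last k) / ((k + 1 + m : ℕ) : ℝ))) := by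
    rw [← Real.exp_add, Finset.sum_neg_distrib, ← Finset.mul_sum]
    congr 1
    push_cast
    field_simp
    ring
  rw [← hexp, one_div_pow]
  ring

/-- Each of the `n - (k + 1)` remaining points must exceed the last coordinate, which contributes
the tail factor. Rate `1 / n` builds the rescaling by `n` into the sample, so these densities
converge without a change of variables. -/
theorem measurePreserving_leftOrderStatistics {k n : ℕ} (h : k + 1 ≤ n) :
    MeasurePreserving (fun (x : Fin n → ℝ) (i : Fin (k + 1)) => orderStatistic x (Fin.castLE h i))
      (Measure.pi fun _ => expMeasure (1 / (n : ℝ)))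
      (volume.withDensity fun u => ENNReal.ofReal (scaledLeftDensity k n u)) := by
  obtain ⟨m, rfl⟩ := Nat.exists_eq_add_of_le h
  have hT : Measurable fun (x : Fin (k + 1 + m) → ℝ) (i : Fin (k + 1)) =>
      orderStatistic x (Fin.castLE h i) :=
    measurable_pi_iff.2 fun i => measurable_orderStatistic _
  have hr : (0 : ℝ) < 1 / ((k + 1 + m : ℕ) : ℝ) := by positivity
  have hpr := isProbabilityMeasure_expMeasure hr
  have hS := (isOpen_strictMono (k + 1)).measurableSet
  have hpdf : Measurable (exponentialPDF (1 / ((k + 1 + m : ℕ) : ℝ))) :=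
    (measurable_exponentialPDFReal _).ennreal_ofReal
  have hprodm : Measurable fun u : Fin (k + 1) → ℝ =>
      ∏ i, exponentialPDF (1 / ((k + 1 + m : ℕ) : ℝ)) (u i) :=
    Finset.measurable_prod _ fun i _ => hpdf.comp (measurable_pi_apply i)
  have hdens : expMeasure (1 / ((k + 1 + m : ℕ) : ℝ))
      = volume.withDensity (exponentialPDF (1 / ((k + 1 + m : ℕ) : ℝ))) := rfl
  refine ⟨hT, ?_⟩
  ext B hB
  rw [Measure.map_apply hT hB, withDensity_apply _ hB]
  have hfm : ((m ! : ℕ) : ℝ≥0∞) ≠ 0 := by exact_mod_cast m.factorial_ne_zero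
  refine (ENNReal.mul_right_inj hfm (ENNReal.natCast_ne_top _)).1 ?_
  have hkey := factorial_mul_lintegral_orderStatistic
    (expMeasure (1 / ((k + 1 + m : ℕ) : ℝ))) (k + 1) m
    (F := B.indicator 1) (measurable_one.indicator hB)
  have hleft : ∫⁻ x, B.indicator (1 : (Fin (k + 1) → ℝ) → ℝ≥0∞)
        (fun i => orderStatistic x (Fin.castAdd m i))
        ∂Measure.pi (fun _ : Fin (k + 1 + m) => expMeasure (1 / ((k + 1 + m : ℕ) : ℝ)))
      = Measure.pi (fun _ : Fin (k + 1 + m) => expMeasure (1 / ((k + 1 + m : ℕ) : ℝ)))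
        ((fun (x : Fin (k + 1 + m) → ℝ) (i : Fin (k + 1)) =>
          orderStatistic x (Fin.castLE h i)) ⁻¹' B) := by
    rw [← lintegral_indicator_one (hT hB)]
    rfl
  rw [hleft] at hkey
  rw [hkey]
  have htail : ∫⁻ u in {u : Fin (k + 1) → ℝ | StrictMono u}, B.indicator 1 u *
        expMeasure (1 / ((k + 1 + m : ℕ) : ℝ)) {y | ∀ i, u i < y} ^ m
        ∂Measure.pi (fun _ => expMeasure (1 / ((k + 1 + m : ℕ) : ℝ)))
      = ∫⁻ u in {u : Fin (k + 1) → ℝ | StrictMono u}, B.indicator 1 u *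
        ENNReal.ofReal (Real.exp (-(1 / ((k + 1 + m : ℕ) : ℝ) * max (u (Fin.last k)) 0))) ^ m
        ∂Measure.pi (fun _ => expMeasure (1 / ((k + 1 + m : ℕ) : ℝ))) := by
    refine setLIntegral_congr_fun hS fun u hu => ?_
    have : {y | ∀ i, u i < y} = Set.Ioi (u (Fin.last k)) := by
      ext y
      exact ⟨fun hy => hy _, fun hy i =>
        (StrictMono.monotone hu (Fin.le_last i)).trans_lt hy⟩
    simp only [this, expMeasure_Ioi hr]
  have hmeas : Measurable fun u : Fin (k + 1) → ℝ => B.indicator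
      (1 : (Fin (k + 1) → ℝ) → ℝ≥0∞) u *
      ENNReal.ofReal (Real.exp (-(1 / ((k + 1 + m : ℕ) : ℝ) * max (u (Fin.last k)) 0))) ^ m :=
    (measurable_one.indicator hB).mul (by fun_prop)
  have hsf : SigmaFinite (volume.withDensity (exponentialPDF (1 / ((k + 1 + m : ℕ) : ℝ)))) := by
    rw [← hdens]
    infer_instance
  rw [htail, hdens, pi_withDensity hpdf,
    setLIntegral_withDensity_eq_setLIntegral_mul _ hprodm hmeas hS, ← volume_pi,
    ← lintegral_indicator hS, ← lintegral_indicator hB,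
    ← lintegral_const_mul' _ _ (ENNReal.natCast_ne_top _),
    ← lintegral_const_mul' _ _ (ENNReal.natCast_ne_top _)]
  congr 1
  ext u
  by_cases huB : u ∈ B
  swap
  · by_cases huS : u ∈ {u : Fin (k + 1) → ℝ | StrictMono u} <;> simp [Set.indicator, huB]
  by_cases huC : u ∈ leftCone k
  · rw [Set.indicator_of_mem (show u ∈ {u : Fin (k + 1) → ℝ | StrictMono u} from huC.2),
      Set.indicator_of_mem huB, ← factorial_mul_prod_exponentialPDF k m huC]
    simp [Set.indicator_of_mem huB]
  · rw [Set.indicator_of_mem huB]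
    have h0 : scaledLeftDensity k (k + 1 + m) u = 0 := Set.indicator_of_notMem huC _
    rw [h0, ENNReal.ofReal_zero, mul_zero, mul_eq_zero]
    right
    by_cases huS : StrictMono u
    · rw [Set.indicator_of_mem (show u ∈ {u : Fin (k + 1) → ℝ | StrictMono u} from huS)]
      have hneg : ∃ i, u i < 0 := by
        by_contra hcon
        push Not at hcon
        exact huC ⟨hcon, huS⟩
      obtain ⟨i, hi⟩ := hneg
      rw [Pi.mul_apply, Finset.prod_eq_zero (Finset.mem_univ i) (exponentialPDF_of_neg hi),
        zero_mul]
    · exact Set.indicator_of_notMem (s := {u : Fin (k + 1) → ℝ | StrictMono u}) huS _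

theorem tendsto_scaledLeftDensity (k : ℕ) (u : Fin (k + 1) → ℝ) :
    Tendsto (fun n => scaledLeftDensity k n u) atTop (𝓝 (limitLeftDensity k u)) := by
  by_cases hu : u ∈ leftCone k
  · simp only [scaledLeftDensity, limitLeftDensity, Set.indicator_of_mem hu]
    have h1 : Tendsto (fun n : ℕ => (n.descFactorial (k + 1) : ℝ) / (n : ℝ) ^ (k + 1)) atTop
        (𝓝 1) := by
      refine (Asymptotics.isEquivalent_iff_tendsto_one ?_).1 (isEquivalent_descFactorial (k + 1))
      filter_upwards [eventually_gt_atTop 0] with n hn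
      positivity
    have hinv : ∀ c : ℝ, Tendsto (fun n : ℕ => c / (n : ℝ)) atTop (𝓝 0) :=
      fun c => tendsto_const_div_atTop_nhds_zero_nat c
    have h2 : Tendsto (fun n : ℕ => -((∑ i, u i) / (n : ℝ)
        + (n - (k + 1)) * u (Fin.last k) / n)) atTop (𝓝 (-u (Fin.last k))) := by
      have : Tendsto (fun n : ℕ => -((∑ i, u i) / (n : ℝ)
          + (u (Fin.last k) - ((k + 1) * u (Fin.last k)) / n))) atTop
          (𝓝 (-(0 + (u (Fin.last k) - 0)))) :=
        ((hinv _).add (tendsto_const_nhds.sub (hinv _))).neg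
      rw [sub_zero, zero_add] at this
      refine this.congr' ?_
      filter_upwards [eventually_gt_atTop 0] with n hn
      have : (0 : ℝ) < n := by positivity
      field_simp
    have := h1.mul ((Real.continuous_exp.tendsto _).comp h2)
    rwa [one_mul] at this
  · simp only [scaledLeftDensity, limitLeftDensity, Set.indicator_of_notMem hu]
    exact tendsto_const_nhds

/-- For `n ≥ 2 (k + 1)` the exponent contains at least half the last coordinate. That coordinate is
the largest, hence at least the average of all `k + 1`; this gives an integrable product bound
independent of `n`. -/
theorem scaledLeftDensity_le {k n : ℕ} (hn : 2 * (k + 1) ≤ n) (u : Fin (k + 1) → ℝ) :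
    scaledLeftDensity k n u
      ≤ ∏ i, (Set.Ici 0).indicator (fun t => Real.exp (-(1 / (2 * (k + 1))) * t)) (u i) := by
  by_cases hu : u ∈ leftCone k
  · have hn0 : (0 : ℝ) < n := by
      have : 0 < n := by omega
      positivity
    have hnk : 2 * ((k : ℝ) + 1) ≤ n := by exact_mod_cast hn
    rw [scaledLeftDensity, Set.indicator_of_mem hu]
    have hprod : ∏ i, (Set.Ici 0).indicator (fun t => Real.exp (-(1 / (2 * (k + 1))) * t)) (u i)
        = Real.exp (∑ i, -(1 / (2 * ((k : ℝ) + 1))) * u i) := by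
      rw [Real.exp_sum]
      exact Finset.prod_congr rfl fun i _ => Set.indicator_of_mem (hu.1 i) _
    rw [hprod, ← one_mul (Real.exp (∑ i, -(1 / (2 * ((k : ℝ) + 1))) * u i))]
    have hle : ∑ i, u i ≤ (k + 1) * u (Fin.last k) := by
      refine (Finset.sum_le_sum fun i _ => hu.2.monotone (Fin.le_last i)).trans_eq ?_
      simp
    have hsum : 0 ≤ ∑ i, u i := Finset.sum_nonneg fun i _ => hu.1 i
    have hl : 0 ≤ u (Fin.last k) := hu.1 _
    refine mul_le_mul ?_ (Real.exp_le_exp.2 ?_) (by positivity) zero_le_one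
    · rw [div_le_one (by positivity)]
      exact_mod_cast Nat.descFactorial_le_pow n (k + 1)
    · rw [← Finset.mul_sum, neg_mul, neg_le_neg_iff]
      have h1 : 1 / (2 * ((k : ℝ) + 1)) * ∑ i, u i ≤ u (Fin.last k) / 2 := by
        rw [div_mul_eq_mul_div, one_mul, div_le_iff₀ (by positivity)]
        linarith
      have h2 : u (Fin.last k) / 2 ≤ (n - (k + 1)) * u (Fin.last k) / n := by
        rw [div_le_div_iff₀ two_pos hn0]
        nlinarith
      have h3 : 0 ≤ (∑ i, u i) / n := by positivity
      linarith
  · rw [scaledLeftDensity, Set.indicator_of_notMem hu]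
    exact Finset.prod_nonneg fun i _ => Set.indicator_nonneg (fun _ _ => by positivity) _

theorem integrable_prod_exp (k : ℕ) : Integrable fun u : Fin (k + 1) → ℝ =>
    ∏ i, (Set.Ici 0).indicator (fun t => Real.exp (-(1 / (2 * (k + 1))) * t)) (u i) := by
  refine Integrable.fintype_prod fun i => ?_
  rw [integrable_indicator_iff measurableSet_Ici, integrableOn_Ici_iff_integrableOn_Ioi]
  exact exp_neg_integrableOn_Ioi 0 (by positivity)

/-! ### Left end: the maximum quotient and its limit law. -/

/-- The largest quotient of corresponding coordinates of two vectors. -/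
noncomputable def maxQuotient (k : ℕ) (z : (Fin (k + 1) → ℝ) × (Fin (k + 1) → ℝ)) : ℝ :=
  ⨆ i, z.1 i / z.2 i

theorem measurable_maxQuotient (k : ℕ) : Measurable (maxQuotient k) :=
  Measurable.iSup fun i => ((measurable_pi_apply i).comp measurable_fst).div
    ((measurable_pi_apply i).comp measurable_snd)

theorem maxRankedQuotient_leftRanks {k n : ℕ} (h : k + 1 ≤ n) (x y : Fin n → ℝ) :
    maxRankedQuotient (leftRanks (k + 1)) x y = maxQuotient k
      (fun i => orderStatistic x (Fin.castLE h i), fun i => orderStatistic y (Fin.castLE h i)) := by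
  let e : Fin (k + 1) ≃ {i : Fin n // (i : ℕ) + 1 ∈ leftRanks (k + 1)} :=
    { toFun := fun i => ⟨Fin.castLE h i, by simp [leftRanks]; omega⟩
      invFun := fun i => ⟨i.1, by have := i.2.2; omega⟩
      left_inv := fun i => rfl
      right_inv := fun i => rfl }
  unfold maxRankedQuotient maxQuotient
  exact (Equiv.iSup_comp (g := fun i : {i : Fin n // (i : ℕ) + 1 ∈ leftRanks (k + 1)} =>
    orderStatistic x i / orderStatistic y i) e).symm

/-- The joint law of the first points of two independent unit Poisson processes. -/
noncomputable def limitLeftMeasure (k : ℕ) :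
    Measure ((Fin (k + 1) → ℝ) × (Fin (k + 1) → ℝ)) :=
  volume.withDensity fun z => ENNReal.ofReal (limitLeftDensity k z.1 * limitLeftDensity k z.2)

/-- Convergence of densities permits test functions that are merely bounded and measurable, so the
discontinuities of `maxQuotient` at zero denominators do no harm. -/
theorem tendsto_integral_scaledLeftDensity (k : ℕ)
    {f : (Fin (k + 1) → ℝ) × (Fin (k + 1) → ℝ) → ℝ} (hf : Measurable f) {C : ℝ}
    (hC : ∀ z, |f z| ≤ C) :
    Tendsto (fun n => ∫ z, scaledLeftDensity k n z.1 * scaledLeftDensity k n z.2 * f z) atTop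
      (𝓝 (∫ z, limitLeftDensity k z.1 * limitLeftDensity k z.2 * f z)) := by
  set b : (Fin (k + 1) → ℝ) → ℝ := fun u =>
    ∏ i, (Set.Ici 0).indicator (fun t => Real.exp (-(1 / (2 * (k + 1))) * t)) (u i) with hb
  have hb0 : ∀ u, 0 ≤ b u := fun u =>
    Finset.prod_nonneg fun i _ => Set.indicator_nonneg (fun _ _ => by positivity) _
  refine tendsto_integral_filter_of_dominated_convergence (fun z => b z.1 * b z.2 * C) ?_ ?_ ?_ ?_
  · refine Eventually.of_forall fun n => Measurable.aestronglyMeasurable ?_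
    exact (((measurable_scaledLeftDensity k n).comp measurable_fst).mul
      ((measurable_scaledLeftDensity k n).comp measurable_snd)).mul hf
  · filter_upwards [eventually_ge_atTop (2 * (k + 1))] with n hn
    refine Eventually.of_forall fun z => ?_
    have h0 := scaledLeftDensity_nonneg k n
    rw [Real.norm_eq_abs, abs_mul, abs_mul, abs_of_nonneg (h0 _), abs_of_nonneg (h0 _)]
    exact mul_le_mul (mul_le_mul (scaledLeftDensity_le hn _) (scaledLeftDensity_le hn _) (h0 _)
      (hb0 _)) (hC z) (abs_nonneg _) (mul_nonneg (hb0 _) (hb0 _))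
  · exact ((integrable_prod_exp k).mul_prod (integrable_prod_exp k)).mul_const C
  · refine Eventually.of_forall fun z => ?_
    exact ((tendsto_scaledLeftDensity k z.1).mul (tendsto_scaledLeftDensity k z.2)).mul_const _

theorem integral_limitLeftMeasure (k : ℕ) (f : (Fin (k + 1) → ℝ) × (Fin (k + 1) → ℝ) → ℝ) :
    ∫ z, f z ∂limitLeftMeasure k
      = ∫ z, limitLeftDensity k z.1 * limitLeftDensity k z.2 * f z := by
  rw [limitLeftMeasure, integral_withDensity_eq_integral_toReal_smul]
  · refine integral_congr_ae (Eventually.of_forall fun z => ?_)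
    simp only [smul_eq_mul]
    rw [ENNReal.toReal_ofReal (mul_nonneg (limitLeftDensity_nonneg k _)
      (limitLeftDensity_nonneg k _))]
  · exact (((measurable_limitLeftDensity k).comp measurable_fst).mul
      ((measurable_limitLeftDensity k).comp measurable_snd)).ennreal_ofReal
  · exact Eventually.of_forall fun _ => ENNReal.ofReal_lt_top

theorem ProbabilityTheory.iIndepFun.hasLaw_prod_pi {Ω ι ι' : Type*} [Fintype ι] [Fintype ι'] [MeasurableSpace Ω]
    {P : Measure Ω} {X : ι → Ω → ℝ} {Y : ι' → Ω → ℝ} {μ ν : Measure ℝ} [SigmaFinite μ]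
    [SigmaFinite ν] (hX : ∀ i, HasLaw (X i) μ P) (hY : ∀ i, HasLaw (Y i) ν P)
    (hXY : iIndepFun (Sum.elim X Y) P) :
    HasLaw (fun ω => ((X · ω), (Y · ω)))
      ((Measure.pi fun _ : ι => μ).prod (Measure.pi fun _ : ι' => ν)) P := by
  have hlaw : ∀ s, HasLaw (Sum.elim X Y s) (Sum.elim (fun _ : ι => μ) (fun _ : ι' => ν) s) P := by
    rintro (i | i)
    · exact hX i
    · exact hY i
  have : ∀ s, SigmaFinite (Sum.elim (fun _ : ι => μ) (fun _ : ι' => ν) s) := by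
    rintro (i | i)
    · exact ‹SigmaFinite μ›
    · exact ‹SigmaFinite ν›
  exact (measurePreserving_sumPiEquivProdPi
    (Sum.elim (fun _ : ι => μ) (fun _ : ι' => ν))).fun_comp_hasLaw (hXY.hasLaw_pi hlaw)

theorem integral_maxRankedQuotient_leftRanks {Ω : Type*} [MeasurableSpace Ω] {P : Measure Ω}
    {k n : ℕ} (h : k + 1 ≤ n) {X Y : Fin n → Ω → ℝ}
    (hX : ∀ i, HasLaw (X i) (expMeasure (1 / (n : ℝ))) P)
    (hY : ∀ i, HasLaw (Y i) (expMeasure (1 / (n : ℝ))) P)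
    (hXY : iIndepFun (Sum.elim X Y) P) {f : ℝ → ℝ} (hf : Measurable f) :
    ∫ ω, f (maxRankedQuotient (leftRanks (k + 1)) (X · ω) (Y · ω)) ∂P
      = ∫ z, scaledLeftDensity k n z.1 * scaledLeftDensity k n z.2 * f (maxQuotient k z) := by
  have hn : (0 : ℝ) < 1 / (n : ℝ) := by
    have : 0 < n := by omega
    positivity
  have hpr := isProbabilityMeasure_expMeasure hn
  have hmp := measurePreserving_leftOrderStatistics h
  have hsf : SFinite ((volume : Measure (Fin (k + 1) → ℝ)).withDensity fun u =>
    ENNReal.ofReal (scaledLeftDensity k n u)) := inferInstance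
  have hlaw := (hmp.prod hmp).fun_comp_hasLaw (iIndepFun.hasLaw_prod_pi hX hY hXY)
  have hm := (measurable_scaledLeftDensity k n).ennreal_ofReal
  simp_rw [maxRankedQuotient_leftRanks h]
  have hcomp := hlaw.integral_comp (f := fun z => f (maxQuotient k z))
    (hf.comp (measurable_maxQuotient k)).aestronglyMeasurable
  refine hcomp.trans ?_
  rw [prod_withDensity hm hm, integral_withDensity_eq_integral_toReal_smul]
  · refine integral_congr_ae (Eventually.of_forall fun z => ?_)
    simp only [smul_eq_mul]
    rw [ENNReal.toReal_mul, ENNReal.toReal_ofReal (scaledLeftDensity_nonneg k n _),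
      ENNReal.toReal_ofReal (scaledLeftDensity_nonneg k n _)]
  · exact (hm.comp measurable_fst).mul (hm.comp measurable_snd)
  · exact Eventually.of_forall fun _ => ENNReal.mul_lt_top ENNReal.ofReal_lt_top
      ENNReal.ofReal_lt_top

theorem isProbabilityMeasure_limitLeftMeasure (k : ℕ) :
    IsProbabilityMeasure (limitLeftMeasure k) := by
  have hone : ∀ n, k + 1 ≤ n →
      ∫ z : (Fin (k + 1) → ℝ) × (Fin (k + 1) → ℝ),
        scaledLeftDensity k n z.1 * scaledLeftDensity k n z.2 * 1 = 1 := by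
    intro n h
    have hn : (0 : ℝ) < 1 / (n : ℝ) := by
      have : 0 < n := by omega
      positivity
    have hpr := isProbabilityMeasure_expMeasure hn
    -- The total mass is not computed directly: coordinates on a product space realize the two
    -- samples, so each scaled density has mass `1`, and dominated convergence carries this to the
    -- limit.
    have := integral_maxRankedQuotient_leftRanks h
      (P := Measure.pi fun _ : Fin n ⊕ Fin n => expMeasure (1 / (n : ℝ)))
      (X := fun i x => x (Sum.inl i)) (Y := fun i x => x (Sum.inr i))
      (fun i => (measurePreserving_eval (fun _ : Fin n ⊕ Fin n => expMeasure (1 / (n : ℝ)))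
        (Sum.inl i)).hasLaw)
      (fun i => (measurePreserving_eval (fun _ : Fin n ⊕ Fin n => expMeasure (1 / (n : ℝ)))
        (Sum.inr i)).hasLaw)
      (by
        have hind := iIndepFun_pi (μ := fun _ : Fin n ⊕ Fin n => expMeasure (1 / (n : ℝ)))
          (X := fun _ => id) fun _ => aemeasurable_id
        convert hind using 1
        ext s
        rcases s with i | i <;> rfl) (f := fun _ => 1) measurable_const
    rw [← this, integral_const, probReal_univ, one_smul]
  have hlim := tendsto_integral_scaledLeftDensity k (f := fun _ => 1) measurable_const (C := 1)
    fun _ => by simp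
  have h1 : ∫ z : (Fin (k + 1) → ℝ) × (Fin (k + 1) → ℝ),
      limitLeftDensity k z.1 * limitLeftDensity k z.2 * 1 = 1 := by
    refine tendsto_nhds_unique hlim (tendsto_const_nhds.congr' ?_)
    filter_upwards [eventually_ge_atTop (k + 1)] with n hn using (hone n hn).symm
  rw [← integral_limitLeftMeasure k (fun _ => 1)] at h1
  rw [integral_const, smul_eq_mul, mul_one, measureReal_def] at h1
  exact ⟨(ENNReal.toReal_eq_one_iff _).1 h1⟩

/-- On strictly positive increasing vectors the density is positive and the quotient continuous, so
an almost sure constant would be its value everywhere there. But `(v, v)` gives `1` and `(2 v, v)`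
gives `2`. -/
theorem not_ae_maxQuotient_eq (k : ℕ) (c : ℝ) :
    ¬ ∀ᵐ z ∂limitLeftMeasure k, maxQuotient k z = c := by
  intro hae
  rw [limitLeftMeasure, ae_withDensity_iff] at hae
  swap
  · exact (((measurable_limitLeftDensity k).comp measurable_fst).mul
      ((measurable_limitLeftDensity k).comp measurable_snd)).ennreal_ofReal
  set U : Set (Fin (k + 1) → ℝ) := {u | (∀ i, 0 < u i) ∧ StrictMono u} with hU
  have hUo : IsOpen U := by
    have : U = (⋂ i, {u : Fin (k + 1) → ℝ | 0 < u i}) ∩ {u | StrictMono u} := by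
      ext u
      simp [hU]
    rw [this]
    exact (isOpen_iInter_of_finite fun i => isOpen_lt continuous_const
      (continuous_apply i)).inter (isOpen_strictMono _)
  have hUU : IsOpen (U ×ˢ U) := hUo.prod hUo
  have hdens : ∀ u ∈ U, 0 < limitLeftDensity k u := fun u hu => by
    rw [limitLeftDensity, Set.indicator_of_mem (show u ∈ leftCone k from
      ⟨fun i => (hu.1 i).le, hu.2⟩)]
    positivity
  have heq : maxQuotient k =ᵐ[volume.restrict (U ×ˢ U)] fun _ => c := by
    rw [EventuallyEq, ae_restrict_iff' hUU.measurableSet]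
    filter_upwards [hae] with z hz hzU
    exact hz (ENNReal.ofReal_pos.2 (mul_pos (hdens _ hzU.1) (hdens _ hzU.2))).ne'
  have hcont : ContinuousOn (maxQuotient k) (U ×ˢ U) := by
    have : maxQuotient k = fun z => Finset.univ.sup' Finset.univ_nonempty
        fun i => z.1 i / z.2 i := by
      ext z
      rw [maxQuotient, Finset.sup'_univ_eq_ciSup]
    rw [this]
    refine ContinuousOn.finset_sup'_apply _ fun i _ => ContinuousOn.div (by fun_prop) (by fun_prop)
      fun z hz => (hz.2.1 i).ne'
  have hon := Measure.eqOn_open_of_ae_eq heq hUU hcont continuousOn_const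
  set v : Fin (k + 1) → ℝ := fun i => (i : ℕ) + 1 with hv
  have hv0 : ∀ i, 0 < v i := fun i => by positivity
  have hvm : StrictMono v := fun i j hij => by
    have : (i : ℕ) < j := hij
    simp only [hv]
    gcongr
  have hvU : v ∈ U := ⟨hv0, hvm⟩
  have h2vU : (fun i => 2 * v i) ∈ U :=
    ⟨fun i => mul_pos two_pos (hv0 i), fun i j hij => by
      have := hvm hij
      simp only
      linarith⟩
  have h1 := hon (show (v, v) ∈ U ×ˢ U from ⟨hvU, hvU⟩)
  have h2 := hon (show ((fun i => 2 * v i), v) ∈ U ×ˢ U from ⟨h2vU, hvU⟩)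
  simp only [maxQuotient, div_self (hv0 _).ne', mul_div_cancel_right₀ _ (hv0 _).ne',
    ciSup_const] at h1 h2
  linarith

theorem tendstoInDistribution_maxRankedQuotient_leftRanks {Ω : Type*} [MeasurableSpace Ω]
    {P : Measure Ω} [IsProbabilityMeasure P] {r : ℝ} (hr : 0 < r) {X Y : (n : ℕ) → Fin n → Ω → ℝ}
    (hX : ∀ n i, HasLaw (X n i) (expMeasure r) P) (hY : ∀ n i, HasLaw (Y n i) (expMeasure 1) P)
    (hXY : ∀ n, iIndepFun (Sum.elim (X n) (Y n)) P) (k : ℕ) :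
    ∃ (ν : Measure ℝ) (_ : IsProbabilityMeasure ν), (∀ c : ℝ, ν ≠ Measure.dirac c) ∧
      TendstoInDistribution
        (fun n ω => maxRankedQuotient (leftRanks (k + 1)) (X n · ω) (Y n · ω))
        atTop id (fun _ => P) ν := by
  have hpr := isProbabilityMeasure_limitLeftMeasure k
  have hhm : Measurable fun z => 1 / r * maxQuotient k z :=
    (measurable_maxQuotient k).const_mul _
  have hνpr : IsProbabilityMeasure ((limitLeftMeasure k).map fun z => 1 / r * maxQuotient k z) :=
    Measure.isProbabilityMeasure_map hhm.aemeasurable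
  have hmeas : ∀ n, AEMeasurable
      (fun ω => maxRankedQuotient (leftRanks (k + 1)) (X n · ω) (Y n · ω)) P := fun n =>
    (measurable_maxRankedQuotient (leftRanks (k + 1))).comp_aemeasurable
      (f := fun ω => ((X n · ω), (Y n · ω)))
      ((aemeasurable_pi_lambda _ fun i => (hX n i).aemeasurable).prodMk
        (aemeasurable_pi_lambda _ fun i => (hY n i).aemeasurable))
  refine ⟨(limitLeftMeasure k).map fun z => 1 / r * maxQuotient k z, hνpr, fun c hc => ?_,
    hmeas, aemeasurable_id, ?_⟩
  · refine not_ae_maxQuotient_eq k (r * c) ?_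
    have : ∀ᵐ x ∂(limitLeftMeasure k).map (fun z => 1 / r * maxQuotient k z), x = c := by
      rw [hc]
      exact (ae_dirac_iff (p := fun x => x = c) (measurableSet_singleton c)).2 rfl
    filter_upwards [ae_of_ae_map hhm.aemeasurable this] with z hz
    rw [← hz]
    field_simp
  · refine ProbabilityMeasure.tendsto_iff_forall_integral_tendsto.2 fun f => ?_
    simp only [ProbabilityMeasure.coe_mk, Measure.map_id]
    rw [integral_map hhm.aemeasurable f.continuous.aestronglyMeasurable, integral_limitLeftMeasure]
    have hfm : Measurable fun x => f (1 / r * x) :=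
      f.continuous.measurable.comp (measurable_const_mul _)
    refine (tendsto_integral_scaledLeftDensity k (hfm.comp (measurable_maxQuotient k)) (C := ‖f‖)
      fun z => f.norm_coe_le_norm _).congr' ?_
    filter_upwards [eventually_ge_atTop (k + 1)] with n hn
    have hn0 : (0 : ℝ) < n := by
      have : 0 < n := by omega
      positivity
    rw [integral_map (hmeas n) f.continuous.aestronglyMeasurable]
    -- Multiplying by `n r` and `n` gives both samples rate `1 / n` and multiplies the quotient by
    -- `r`, which the factor `1 / r` in the limit law undoes.
    have hXr : ∀ i, HasLaw (fun ω => n * r * X n i ω) (expMeasure (1 / (n : ℝ))) P := fun i => by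
      have := HasLaw.const_mul_expMeasure hr (mul_pos hn0 hr) (hX n i)
      convert this using 2
      field_simp
    have hYr : ∀ i, HasLaw (fun ω => n * Y n i ω) (expMeasure (1 / (n : ℝ))) P := fun i =>
      HasLaw.const_mul_expMeasure one_pos hn0 (hY n i)
    have hind : iIndepFun (Sum.elim (fun i ω => n * r * X n i ω) (fun i ω => n * Y n i ω)) P := by
      have := (hXY n).comp (Sum.elim (fun _ x => n * r * x) (fun _ x => n * x)) (by
        rintro (i | i)
        · exact measurable_const_mul _
        · exact measurable_const_mul _)
      convert this using 1
      ext s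
      rcases s with i | i <;> rfl
    refine (integral_maxRankedQuotient_leftRanks hn hXr hYr hind hfm).symm.trans ?_
    refine integral_congr_ae (Eventually.of_forall fun ω => ?_)
    simp only
    rw [maxRankedQuotient_const_mul _ (mul_pos hn0 hr) hn0]
    congr 1
    field_simp

/-! ### The three ranges together. -/

theorem mainTheorem11 {Ω : Type*} [MeasurableSpace Ω] (P : Measure Ω) [IsProbabilityMeasure P]
    (δ : ℝ) (hδ : -1 < δ)
    (X Y : (n : ℕ) → Fin n → Ω → ℝ)
    (hX : ∀ n i, HasLaw (X n i) (expMeasure (1 + δ)) P)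
    (hY : ∀ n i, HasLaw (Y n i) (expMeasure 1) P)
    (hXY : ∀ n, iIndepFun (Sum.elim (X n) (Y n)) P) :
    (∀ α β : ℕ → ℝ, TruncationCondition α β →
      (∀ᶠ n in atTop, (middleRanks n (α n) (β n)).Nonempty) →
      TendstoInMeasure P
        (fun n ω => maxRankedQuotient (middleRanks n (α n) (β n)) (X n · ω) (Y n · ω))
        atTop (fun _ => 1 / (1 + δ))) ∧
    (∀ k : ℕ, 1 ≤ k →
      TendstoInMeasure P
        (fun n ω => maxRankedQuotient (rightRanks n k) (X n · ω) (Y n · ω))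
        atTop (fun _ => 1 / (1 + δ))) ∧
    (∀ k : ℕ, 1 ≤ k →
      ∃ (ν : Measure ℝ) (_ : IsProbabilityMeasure ν), (∀ c : ℝ, ν ≠ Measure.dirac c) ∧
        TendstoInDistribution
          (fun n ω => maxRankedQuotient (leftRanks k) (X n · ω) (Y n · ω))
          atTop id (fun _ => P) ν) := by
  have hr : 0 < 1 + δ := by linarith
  have hXi : ∀ n, iIndepFun (X n) P := fun n => iIndepFun.precomp (g := Sum.inl) Sum.inl_injective (hXY n)
  have hYi : ∀ n, iIndepFun (Y n) P := fun n => iIndepFun.precomp (g := Sum.inr) Sum.inr_injective (hXY n)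
  refine ⟨fun α β h hne => ?_, fun k hk => ?_, fun k hk => ?_⟩
  · refine tendstoInMeasure_maxRankedQuotient hr ?_ ?_
      (uniformRelativeConvergence_middleRanks hr hX hXi h)
      (uniformRelativeConvergence_middleRanks one_pos hY hYi h)
    · filter_upwards [h.eventually_mem] with n ⟨hα, _, hβ⟩ i ⟨hi1, hi2⟩
      have hn : (0 : ℝ) < n := by exact_mod_cast i.pos
      push_cast at hi2
      rw [← div_lt_iff₀ hn] at hi2
      have : 0 < ((i : ℕ) + 1 : ℝ) / n := by positivity
      exact neg_pos.2 (Real.log_neg (by linarith) (by linarith))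
    · filter_upwards [h.eventually_mem, hne, eventually_gt_atTop 0] with n ⟨hα, _, hβ⟩ ⟨i, hi⟩ hn0
      have hn : (0 : ℝ) < n := by exact_mod_cast hn0
      have h0 : 0 < i := by
        have : (0 : ℝ) < i := (mul_pos hα hn).trans hi.1
        exact_mod_cast this
      have h1 : i < n := by
        have : (i : ℝ) < n := hi.2.trans (by nlinarith)
        exact_mod_cast this
      refine ⟨⟨i - 1, by omega⟩, ?_⟩
      simpa only [Nat.sub_add_cancel (show 1 ≤ i from h0)] using hi
  · refine tendstoInMeasure_maxRankedQuotient hr ?_ ?_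
      (uniformRelativeConvergence_rightRanks hr hX hXi k)
      (uniformRelativeConvergence_rightRanks one_pos hY hYi k)
    · filter_upwards [eventually_gt_atTop 1] with n hn i _
      exact Real.log_pos (by exact_mod_cast hn)
    · filter_upwards [eventually_gt_atTop 0] with n hn
      refine ⟨⟨n - 1, by omega⟩, ?_, ?_⟩ <;> simp only <;> omega
  · obtain ⟨k, rfl⟩ := Nat.exists_eq_add_of_le' hk
    exact tendstoInDistribution_maxRankedQuotient_leftRanks hr hX hY hXY k
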